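/- Setting. Let $G$ be a connected undirected graph with vertex set $\{1,\dots,m\}$ and diameter $d$; player $i$ sits at vertex $i$ and holds a vector $X_i\in\{0,1,\dots,M\}^n$. Put $\mathcal X=\sum_{i=1}^m X_i$ and $F_p=\sum_{j=1}^n|\mathcal X_j|^p$. A (public-coin) protocol in the message-passing model on $G$ runs in rounds. A schedule fixed in advance says which players send in a given round, each to one of its neighbours in $G$; a message is a bit string that depends only on the sender's input, on a finite string of uniform random bits shared by all players, and on the messages the sender received in earlier rounds, and it is seen only by its recipient. At the end a distinguished player $\mathcal C$ outputs a real number computed from its input, the shared bits and the messages it received. The protocol is one-shot if every player other than $\mathcal C$ sends exactly one message, all messages it receives arrive in the round immediately before the one in which it sends, $\mathcal C$ sends nothing, and all messages to $\mathcal C$ arrive in a single round. The max-communication is the largest number of bits sent across an edge (in both directions together) during the execution, and the total communication is the number of bits in all messages. Theorem. For every constant $c\in\mathbb N$ there is a constant $K>0$, depending only on $c$, such that for all $p\in(1,2]$, $\epsilon\in(0,1)$, all $n,M,m$ with $m\le c\,n^c$ and $M\le c\,n^c$, and every connected graph $G$ on $m$ vertices with diameter $d$, there is a one-shot protocol on $G$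 which, for all inputs $X_1,\dots,X_m\in\{0,\dots,M\}^n$, outputs a number in $[(1-\epsilon)F_p,(1+\epsilon)F_p]$ with probability at least $3/4$, and which, for all such inputs and all outcomes of the random bits, has max-communication at most $$B=\frac{K}{\epsilon^{2}}\Big(\log\log (n+3)+\log d+\log\frac1\epsilon\Big)$$ bits and total communication at most $mB$ bits. Moreover, there is an absolute constant $K>0$ such that the same holds for all $n,M,m$, without the assumptions $m\le c\,n^c$ and $M\le c\,n^c$, when $\log\log(n+3)$ is replaced by $\log\log(mnM+3)$. (For $m=1$, where $d=0$, the term $\log d$ is read as $0$; the shift by $3$ only keeps the iterated logarithm positive for small arguments.) -/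

import Mathlib

namespace MsgPassing

/-- What a player has received so far: the entry at position `t` of the list tells, for each player
`i`, which bit string (if any) was received from `i` in round `t`. -/
abbrev View (m : ℕ) : Type := List (Fin m → Option (List Bool))

/-- A public-coin protocol in the message passing model on the graph `G`, whose `m` players sit at
the vertices of `G` and hold vectors with `n` non-negative integer entries. The schedule (who sends
to whom in which round) is fixed in advance; the content of a message may depend only on the
sender's own input, the shared random bits, and the messages the sender received in earlier
rounds. -/
structure Protocol {m : ℕ} (G : SimpleGraph (Fin m)) (n : ℕ) where
  /-- the number of shared random bits -/
  coins : ℕ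
  /-- the number of rounds; the rounds are `0, …, rounds - 1` -/
  rounds : ℕ
  /-- `target t i = some j`: in round `t` player `i` sends a message to player `j`;
  `target t i = none`: in round `t` player `i` sends nothing -/
  target : ℕ → Fin m → Option (Fin m)
  /-- messages travel along edges only -/
  target_adj : ∀ t i j, target t i = some j → G.Adj i j
  /-- the message of player `i` in round `t` (if the schedule lets it send one) -/
  message : ℕ → Fin m → (Fin n → ℕ) → (Fin coins → Bool) → View m → List Bool
  /-- the distinguished player, who holds the estimate at the end -/
  center : Fin m
  /-- the estimate, a function of the center's input, the shared bits and the center's view -/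
  output : (Fin n → ℕ) → (Fin coins → Bool) → View m → ℝ

namespace Protocol

variable {m n : ℕ} {G : SimpleGraph (Fin m)} (P : Protocol G n)

/-- `P.view X ω t j`: everything player `j` has received in the first `t` rounds, when the inputs
are `X` and the shared random bits are `ω`. -/
def view (X : Fin m → Fin n → ℕ) (ω : Fin P.coins → Bool) : ℕ → Fin m → View m
  | 0, _ => []
  | t + 1, j => view X ω t j ++ [fun i =>
      if P.target t i = some j then some (P.message t i (X i) ω (view X ω t i)) else none]

/-- The number of bits sent from player `i` to player `j` over the whole execution. -/
def bitsSent (X : Fin m → Fin n → ℕ) (ω : Fin P.coins → Bool) (i j : Fin m) : ℕ :=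
  ∑ t ∈ Finset.range P.rounds,
    if P.target t i = some j then (P.message t i (X i) ω (P.view X ω t i)).length else 0

/-- The number of bits sent over the whole execution across the busiest edge, both directions
counted together (pairs that are not edges contribute `0`). -/
def maxComm (X : Fin m → Fin n → ℕ) (ω : Fin P.coins → Bool) : ℕ :=
  Finset.univ.sup fun e : Fin m × Fin m => P.bitsSent X ω e.1 e.2 + P.bitsSent X ω e.2 e.1

/-- The number of bits in all messages of the execution. -/
def totalComm (X : Fin m → Fin n → ℕ) (ω : Fin P.coins → Bool) : ℕ :=
  ∑ i, ∑ j, P.bitsSent X ω i j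

/-- The value held by the center at the end of the execution. -/
def result (X : Fin m → Fin n → ℕ) (ω : Fin P.coins → Bool) : ℝ :=
  P.output (X P.center) ω (P.view X ω P.rounds P.center)

/-- One-shot protocols: every player other than the center sends exactly one message, to one
neighbour, and whatever it receives arrives in the round right before; the center never sends,
and whatever it receives arrives in a single round. -/
def IsOneShot : Prop :=
  (∀ i, i ≠ P.center → ∃ t < P.rounds,
    (P.target t i).isSome ∧
    (∀ t' < P.rounds, t' ≠ t → P.target t' i = none) ∧
    (∀ s < P.rounds, ∀ u, P.target s u = some i → s + 1 = t)) ∧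
  (∀ t < P.rounds, P.target t P.center = none) ∧
  (∃ t, ∀ s < P.rounds, ∀ u, P.target s u = some P.center → s = t)

end Protocol

/-- The probability of an event under `R` independent fair coin tosses. -/
noncomputable def coinProb {R : ℕ} (E : Set (Fin R → Bool)) : ℝ :=
  (E.ncard : ℝ) / 2 ^ R

/-- The moment `F_p = ∑ⱼ |𝒳ⱼ|^p` of the aggregate vector `𝒳 = ∑ᵢ Xᵢ`. -/
noncomputable def Fp {m n : ℕ} (p : ℝ) (X : Fin m → Fin n → ℕ) : ℝ :=
  ∑ j, |∑ i, (X i j : ℝ)| ^ p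

/-- There is a one-shot protocol on `G` which, for all inputs `X₁, …, X_m ∈ {0, …, M}ⁿ`, outputs a
`(1 ± ε)`-approximation of `F_p` with probability at least `3/4`, and which, for all such inputs
and all outcomes of the coins, has max-communication at most `B` and total communication at most
`m * B` bits. -/
def HasOneShotFpProtocol {m : ℕ} (G : SimpleGraph (Fin m)) (n M : ℕ) (p ε B : ℝ) : Prop :=
  ∃ P : Protocol G n, P.IsOneShot ∧
    ∀ X : Fin m → Fin n → ℕ, (∀ i j, X i j ≤ M) →
      3 / 4 ≤ coinProb {ω | P.result X ω ∈ Set.Icc ((1 - ε) * Fp p X) ((1 + ε) * Fp p X)} ∧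
      ∀ ω, (P.maxComm X ω : ℝ) ≤ B ∧ (P.totalComm X ω : ℝ) ≤ m * B

end MsgPassing

/-!
A linear form with i.i.d. `p`-stable coefficients, evaluated at the aggregate `𝒳`, is distributed
as `‖𝒳‖_p` times a stable variable, so the average of the `1/4`-th powers of `O(1/ε²)` independent
such linear forms is concentrated near a multiple of `F_p ^ (1 / (4 p))`. The linear forms are
summed up along a breadth first spanning tree of depth at most `d`. To keep the messages short,
every vertex rounds what it sends to a floating point number, with a random shift that makes the
rounding unbiased.

Unbiasedness makes the rounding errors uncorrelated, so only the sum of their variances matters,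
and relative errors turn this into the sum over all vertices `v` of the squared partial sums below
`v`. The `1/8`-th moment of that sum is controlled by random signs: a square function of stable
forms is again comparable to the `ℓ_p` norm of the coefficients, and since inputs are nonnegative
and `p ≥ 1`, the `p`-th powers of the partial sums over the vertices at one depth add up to at most
`F_p`. Hence a relative precision polynomial in `ε / d` suffices, while exponents are
`O(log (m n M / ε))`; so one number takes `O(log log (m n M) + log d + log (1/ε))` bits.
-/

namespace MsgPassing

open MeasureTheory ProbabilityTheory Filter Topology

/-! ### Symmetric stable laws -/

/-- The probability measure `ν` is the symmetric `p`-stable law, normalized to have scale one. -/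
def IsStable (p : ℝ) (ν : Measure ℝ) : Prop :=
  ∀ t, charFun ν t = ((Real.exp (-|t| ^ p) : ℝ) : ℂ)

lemma exists_charFun_eq_of_tendsto {E : Type*} [NormedAddCommGroup E] [InnerProductSpace ℝ E]
    [FiniteDimensional ℝ E] [MeasurableSpace E] [BorelSpace E]
    {μ : ℕ → ProbabilityMeasure E} {f : E → ℂ} (hf : ContinuousAt f 0)
    (h : ∀ t, Tendsto (fun n ↦ charFun (μ n : Measure E) t) atTop (𝓝 (f t))) :
    ∃ ν : ProbabilityMeasure E, ∀ t, charFun (ν : Measure E) t = f t := by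
  have tight : IsTightMeasureSet (Set.range fun n ↦ (μ n : Measure E)) :=
    isTightMeasureSet_of_tendsto_charFun hf h
  have compact : IsCompact (closure (Set.range μ)) := by
    apply isCompact_closure_of_isTightMeasureSet
    convert tight using 1
    ext ν
    simp
  let U : Ultrafilter ℕ := Ultrafilter.of atTop
  obtain ⟨ν, -, hν⟩ := compact.ultrafilter_le_nhds (U.map μ)
    (le_principal_iff.2 (mem_of_superset (by simp) subset_closure))
  have weak_limit : Tendsto μ U (𝓝 ν) := hν
  rw [ProbabilityMeasure.tendsto_iff_forall_integral_rclike_tendsto ℂ] at weak_limit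
  refine ⟨ν, fun t ↦ ?_⟩
  have charFun_limit := weak_limit (BoundedContinuousFunction.innerProbChar t)
  simp_rw [← charFun_eq_integral_innerProbChar] at charFun_limit
  exact tendsto_nhds_unique charFun_limit ((h t).mono_left (Ultrafilter.of_le _))

/-- The symmetrization of a measure on the real line: the law of a random sign times a variable
with law `μ`. -/
noncomputable def symmetrize (μ : Measure ℝ) : Measure ℝ :=
  (2 : ENNReal)⁻¹ • (μ + μ.map (fun x ↦ -x))

instance (μ : Measure ℝ) [IsProbabilityMeasure μ] : IsProbabilityMeasure (symmetrize μ) := by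
  have : IsProbabilityMeasure (μ.map (fun x ↦ -x)) :=
    Measure.isProbabilityMeasure_map (by fun_prop)
  constructor
  simp only [symmetrize, Measure.smul_apply, Measure.add_apply, measure_univ, smul_eq_mul]
  rw [one_add_one_eq_two]
  exact ENNReal.inv_mul_cancel (by simp) (by simp)

lemma charFun_symmetrize (μ : Measure ℝ) [IsFiniteMeasure μ] (t : ℝ) :
    charFun (symmetrize μ) t = ((∫ x, Real.cos (t * x) ∂μ : ℝ) : ℂ) := by
  have integrable_exp (ν : Measure ℝ) [IsFiniteMeasure ν] (s : ℝ) :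
      Integrable (fun x : ℝ ↦ Complex.exp (s * x * Complex.I)) ν := by
    refine Integrable.of_bound (by fun_prop) 1 (ae_of_all _ fun x ↦ ?_)
    rw [← Complex.ofReal_mul, Complex.norm_exp_ofReal_mul_I]
  rw [charFun_apply_real, symmetrize, integral_smul_measure,
    integral_add_measure (integrable_exp _ t) (integrable_exp _ t),
    integral_map (by fun_prop) (by fun_prop),
    ← integral_add (integrable_exp _ t) (by simpa using integrable_exp μ (-t)),
    ← integral_complex_ofReal, ← integral_smul]
  refine integral_congr_ae (ae_of_all _ fun x ↦ ?_)
  simp only [Complex.ofReal_cos, Complex.cos, ENNReal.toReal_inv, ENNReal.toReal_ofNat,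
    Complex.real_smul]
  push_cast
  ring_nf

/-- The integrand of the Lévy–Khintchine representation `c * |t| ^ p = ∫ (1 - cos (t * u)) / u ^
(p + 1)` of the exponent of the symmetric `p`-stable law, at `t = 1`. -/
noncomputable def levyIntegrand (p u : ℝ) : ℝ := (1 - Real.cos u) * u ^ (-(p + 1))

lemma levyIntegrand_nonneg (p : ℝ) {u : ℝ} (hu : 0 ≤ u) : 0 ≤ levyIntegrand p u :=
  mul_nonneg (by linarith [Real.cos_le_one u]) (Real.rpow_nonneg hu _)

lemma levyIntegrand_le_rpow (p : ℝ) {u : ℝ} (hu : 0 < u) : levyIntegrand p u ≤ u ^ (1 - p) := by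
  have one_sub_cos_le : 1 - Real.cos u ≤ u ^ 2 := by
    nlinarith [Real.one_sub_sq_div_two_le_cos (x := u), sq_nonneg u]
  calc levyIntegrand p u ≤ u ^ 2 * u ^ (-(p + 1)) := by unfold levyIntegrand; gcongr
    _ = u ^ (1 - p) := by
      rw [← Real.rpow_natCast, ← Real.rpow_add hu]
      congr 1
      push_cast
      ring

lemma levyIntegrand_le_two_mul_rpow (p : ℝ) {u : ℝ} (hu : 0 ≤ u) :
    levyIntegrand p u ≤ 2 * u ^ (-(p + 1)) := by
  unfold levyIntegrand
  gcongr
  linarith [Real.neg_one_le_cos u]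

lemma measurable_levyIntegrand (p : ℝ) : Measurable (levyIntegrand p) := by
  unfold levyIntegrand
  fun_prop

lemma integrableOn_levyIntegrand {p : ℝ} (hp : 0 < p) (hp2 : p < 2) :
    IntegrableOn (levyIntegrand p) (Set.Ioi 0) := by
  have near_zero : IntegrableOn (fun u : ℝ ↦ u ^ (1 - p)) (Set.Ioc 0 1) := by
    rw [← intervalIntegrable_iff_integrableOn_Ioc_of_le zero_le_one]
    exact intervalIntegral.intervalIntegrable_rpow' (by linarith)
  have near_infinity : IntegrableOn (fun u : ℝ ↦ 2 * u ^ (-(p + 1))) (Set.Ioi 1) :=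
    (integrableOn_Ioi_rpow_of_lt (by linarith) one_pos).const_mul 2
  have meas := (measurable_levyIntegrand p).aestronglyMeasurable (μ := volume)
  rw [← Set.Ioc_union_Ioi_eq_Ioi (zero_le_one' ℝ)]
  refine IntegrableOn.union (near_zero.mono' meas.restrict ?_)
    (near_infinity.mono' meas.restrict ?_)
  · filter_upwards [ae_restrict_mem measurableSet_Ioc] with u hu
    rw [Real.norm_of_nonneg (levyIntegrand_nonneg p hu.1.le)]
    exact levyIntegrand_le_rpow p hu.1
  · filter_upwards [ae_restrict_mem measurableSet_Ioi] with u hu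
    have hu0 : 0 ≤ u := zero_le_one.trans (le_of_lt hu)
    rw [Real.norm_of_nonneg (levyIntegrand_nonneg p hu0)]
    exact levyIntegrand_le_two_mul_rpow p hu0

lemma integral_levyIntegrand_pos {p : ℝ} (hp : 0 < p) (hp2 : p < 2) :
    0 < ∫ u in Set.Ioi (0 : ℝ), levyIntegrand p u := by
  rw [setIntegral_pos_iff_support_of_nonneg_ae
    ((ae_restrict_mem measurableSet_Ioi).mono fun u hu ↦ levyIntegrand_nonneg p (le_of_lt hu))
    (integrableOn_levyIntegrand hp hp2)]
  refine lt_of_lt_of_le (by simp) (measure_mono (s := Set.Ioo 0 1) fun u hu ↦ ?_)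
  have cos_lt_one : Real.cos u < Real.cos 0 :=
    Real.cos_lt_cos_of_nonneg_of_le_pi le_rfl (by linarith [hu.2, Real.pi_gt_three]) hu.1
  rw [Real.cos_zero] at cos_lt_one
  exact ⟨(mul_pos (sub_pos.2 cos_lt_one) (Real.rpow_pos_of_pos hu.1 _)).ne', hu.1⟩

lemma integral_one_sub_cos_paretoMeasure {p : ℝ} (hp : 0 < p) {t : ℝ} (ht : 0 < t) :
    ∫ x, (1 - Real.cos (t * x)) ∂(paretoMeasure 1 p)
      = p * t ^ p * ∫ u in Set.Ioi t, levyIntegrand p u := by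
  have measurable_density : Measurable (paretoPDF 1 p) :=
    (measurable_paretoPDFReal 1 p).ennreal_ofReal
  have density_mul : (fun x ↦ (paretoPDF 1 p x).toReal • (1 - Real.cos (t * x)))
      = (Set.Ici (1 : ℝ)).indicator
        (fun x ↦ p * x ^ (-(p + 1)) * (1 - Real.cos (t * x))) := by
    ext x
    rw [paretoPDF, ENNReal.toReal_ofReal (paretoPDFReal_nonneg zero_le_one hp.le x),
      paretoPDFReal]
    by_cases hx : 1 ≤ x <;> simp [Set.indicator, hx]
  have rescale : ∀ x ∈ Set.Ioi (1 : ℝ), p * x ^ (-(p + 1)) * (1 - Real.cos (t * x))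
      = p * t ^ (p + 1) * levyIntegrand p (t * x) := fun x hx ↦ by
    have hx0 : (0 : ℝ) < x := one_pos.trans hx
    rw [levyIntegrand, Real.mul_rpow ht.le hx0.le, Real.rpow_neg ht.le]
    have : t ^ (p + 1) ≠ 0 := (Real.rpow_pos_of_pos ht _).ne'
    field_simp
  rw [paretoMeasure, integral_withDensity_eq_integral_toReal_smul measurable_density
    (ae_of_all _ fun x ↦ ENNReal.ofReal_lt_top), density_mul,
    integral_indicator measurableSet_Ici, integral_Ici_eq_integral_Ioi,
    setIntegral_congr_fun measurableSet_Ioi rescale, integral_const_mul,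
    integral_comp_mul_left_Ioi (levyIntegrand p) _ ht, mul_one, Real.rpow_add_one ht.ne',
    smul_eq_mul]
  field_simp

lemma integral_cos_paretoMeasure {p : ℝ} (hp : 0 < p) (t : ℝ) :
    ∫ x, Real.cos (t * x) ∂(paretoMeasure 1 p)
      = 1 - p * |t| ^ p * ∫ u in Set.Ioi |t|, levyIntegrand p u := by
  have := isProbabilityMeasure_paretoMeasure one_pos hp
  rcases eq_or_ne t 0 with rfl | ht
  · simp [Real.zero_rpow hp.ne']
  have integrable_cos : Integrable (fun x ↦ Real.cos (|t| * x)) (paretoMeasure 1 p) :=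
    Integrable.of_bound (by fun_prop) 1 (ae_of_all _ fun x ↦ Real.abs_cos_le_one _)
  have cos_abs_mul (x : ℝ) : Real.cos (|t| * x) = Real.cos (t * x) := by
    rw [← Real.cos_abs, abs_mul, abs_abs, ← abs_mul, Real.cos_abs]
  rw [← integral_one_sub_cos_paretoMeasure hp (abs_pos.2 ht),
    integral_sub (integrable_const 1) integrable_cos]
  simp [cos_abs_mul]

/-- The factor by which the sum of `N` symmetrized Pareto variables is scaled to converge to the
symmetric `p`-stable law of scale one. -/
noncomputable def stableScale (p : ℝ) (N : ℕ) : ℝ :=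
  (N * (p * ∫ u in Set.Ioi 0, levyIntegrand p u)) ^ (-p⁻¹)

/-- The law of the scaled sum of `N` independent symmetrized Pareto variables. -/
noncomputable def scaledParetoSum (p : ℝ) (N : ℕ) : Measure ℝ :=
  ((Measure.pi fun _ : Fin N ↦ symmetrize (paretoMeasure 1 p)).map fun x ↦ ∑ i, x i).map
    (stableScale p N * ·)

lemma isProbabilityMeasure_scaledParetoSum {p : ℝ} (hp : 0 < p) (N : ℕ) :
    IsProbabilityMeasure (scaledParetoSum p N) := by
  have := isProbabilityMeasure_paretoMeasure one_pos hp
  have : IsProbabilityMeasure ((Measure.pi fun _ : Fin N ↦ symmetrize (paretoMeasure 1 p)).map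
      fun x ↦ ∑ i, x i) := Measure.isProbabilityMeasure_map (by fun_prop)
  exact Measure.isProbabilityMeasure_map (by fun_prop)

section

variable {p : ℝ} (hp : 0 < p)

include hp

lemma charFun_scaledParetoSum (N : ℕ) (t : ℝ) :
    charFun (scaledParetoSum p N) t = (((1 + -(p * |stableScale p N * t| ^ p *
      ∫ u in Set.Ioi |stableScale p N * t|, levyIntegrand p u)) ^ N : ℝ) : ℂ) := by
  have := isProbabilityMeasure_paretoMeasure one_pos hp
  rw [scaledParetoSum, charFun_map_mul, charFun_map_sum_pi_eq_prod]
  simp only [Finset.prod_const, Finset.card_univ, Fintype.card_fin, Pi.pow_apply]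
  rw [charFun_symmetrize, integral_cos_paretoMeasure hp]
  push_cast
  ring

variable (hp2 : p < 2)

include hp2

lemma stableScale_nonneg (N : ℕ) : 0 ≤ stableScale p N := by
  have := integral_levyIntegrand_pos hp hp2
  unfold stableScale
  positivity

lemma tendsto_stableScale : Tendsto (stableScale p) atTop (𝓝 0) :=
  (tendsto_rpow_neg_atTop (inv_pos.2 hp)).comp (tendsto_natCast_atTop_atTop.atTop_mul_const
    (mul_pos hp (integral_levyIntegrand_pos hp hp2)))

lemma abs_stableScale_mul_rpow (N : ℕ) (t : ℝ) :
    |stableScale p N * t| ^ p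
      = (N * (p * ∫ u in Set.Ioi 0, levyIntegrand p u))⁻¹ * |t| ^ p := by
  have := integral_levyIntegrand_pos hp hp2
  have scale_nonneg := stableScale_nonneg hp hp2 N
  rw [abs_mul, abs_of_nonneg scale_nonneg, Real.mul_rpow scale_nonneg (abs_nonneg _), stableScale,
    ← Real.rpow_mul (by positivity), neg_mul, inv_mul_cancel₀ hp.ne', Real.rpow_neg_one]

lemma tendsto_integral_Ioi_stableScale (t : ℝ) :
    Tendsto (fun N ↦ ∫ u in Set.Ioi |stableScale p N * t|, levyIntegrand p u) atTop
      (𝓝 (∫ u in Set.Ioi 0, levyIntegrand p u)) := by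
  have endpoint : Tendsto (fun N ↦ |stableScale p N * t|) atTop (𝓝 0) := by
    simpa using ((tendsto_stableScale hp hp2).mul_const t).abs
  refine ((aecover_Ioi_of_Ioi endpoint).integral_tendsto_of_countably_generated
    (integrableOn_levyIntegrand hp hp2)).congr fun N ↦ ?_
  rw [Measure.restrict_restrict measurableSet_Ioi, Set.Ioi_inter_Ioi,
    sup_of_le_left (abs_nonneg _)]

lemma tendsto_charFun_scaledParetoSum (t : ℝ) :
    Tendsto (fun N ↦ charFun (scaledParetoSum p N) t) atTop
      (𝓝 ((Real.exp (-|t| ^ p) : ℝ) : ℂ)) := by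
  have total_pos := integral_levyIntegrand_pos hp hp2
  simp_rw [charFun_scaledParetoSum hp]
  refine (Complex.continuous_ofReal.tendsto _).comp (Real.tendsto_one_add_pow_exp_of_tendsto ?_)
  have limit := (tendsto_integral_Ioi_stableScale hp hp2 t).const_mul
    (-(|t| ^ p / ∫ u in Set.Ioi 0, levyIntegrand p u))
  rw [neg_mul, div_mul_cancel₀ _ total_pos.ne'] at limit
  refine limit.congr' ?_
  filter_upwards [eventually_gt_atTop 0] with N hN
  rw [abs_stableScale_mul_rpow hp hp2]
  field_simp

end

theorem exists_isStable {p : ℝ} (hp : 0 < p) (hp2 : p ≤ 2) :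
    ∃ ν : Measure ℝ, IsProbabilityMeasure ν ∧ IsStable p ν := by
  rcases hp2.eq_or_lt with rfl | hp2
  · refine ⟨gaussianReal 0 2, inferInstance, fun t ↦ ?_⟩
    rw [charFun_gaussianReal, Real.rpow_two, sq_abs]
    simp
  have continuous_limit : Continuous fun t : ℝ ↦ ((Real.exp (-|t| ^ p) : ℝ) : ℂ) := by
    have : Continuous fun t : ℝ ↦ |t| ^ p := continuous_abs.rpow_const fun _ ↦ Or.inr hp.le
    fun_prop
  obtain ⟨ν, hν⟩ := exists_charFun_eq_of_tendsto
    (μ := fun N ↦ ⟨scaledParetoSum p N, isProbabilityMeasure_scaledParetoSum hp N⟩)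
    continuous_limit.continuousAt (tendsto_charFun_scaledParetoSum hp hp2)
  exact ⟨ν, inferInstance, hν⟩

lemma measurable_abs_rpow (q : ℝ) : Measurable fun x : ℝ ↦ |x| ^ q := by fun_prop

lemma measurable_sum_mul {ι : Type*} [Fintype ι] (y : ι → ℝ) :
    Measurable fun z : ι → ℝ ↦ ∑ j, z j * y j := by fun_prop

lemma lintegral_Ioc_zero_one_rpow {q : ℝ} (hq : 0 < q) :
    ∫⁻ t in Set.Ioc (0 : ℝ) 1, ENNReal.ofReal (t ^ (q - 1)) = ENNReal.ofReal (1 / q) := by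
  have integrable : IntegrableOn (fun t : ℝ ↦ t ^ (q - 1)) (Set.Ioc 0 1) := by
    rw [← intervalIntegrable_iff_integrableOn_Ioc_of_le zero_le_one]
    exact intervalIntegral.intervalIntegrable_rpow' (by linarith)
  rw [← ofReal_integral_eq_lintegral_ofReal integrable
    ((ae_restrict_mem measurableSet_Ioc).mono fun t ht ↦ Real.rpow_nonneg ht.1.le _),
    ← intervalIntegral.integral_of_le zero_le_one, integral_rpow (Or.inl (by linarith))]
  simp [Real.zero_rpow hq.ne']

lemma lintegral_Ioi_one_rpow {q : ℝ} (hq : q < 1) :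
    ∫⁻ t in Set.Ioi (1 : ℝ), ENNReal.ofReal (t ^ (q - 2)) = ENNReal.ofReal (1 / (1 - q)) := by
  rw [← ofReal_integral_eq_lintegral_ofReal (integrableOn_Ioi_rpow_of_lt (by linarith) one_pos)
    ((ae_restrict_mem measurableSet_Ioi).mono fun t ht ↦
      Real.rpow_nonneg (zero_le_one.trans (le_of_lt ht)) _),
    integral_Ioi_rpow_of_lt (by linarith) one_pos, Real.one_rpow, ← neg_div_neg_eq, neg_neg]
  congr 2
  ring

lemma lintegral_abs_rpow_le_of_tail_le {ν : Measure ℝ} [IsProbabilityMeasure ν] {C : ℝ}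
    (hC : 0 ≤ C) (htail : ∀ r, 0 < r → ν.real {x | r < |x|} ≤ C / r) {q : ℝ} (hq : 0 < q)
    (hq1 : q < 1) :
    ∫⁻ x, ENNReal.ofReal (|x| ^ q) ∂ν ≤ ENNReal.ofReal (1 + C * q / (1 - q)) := by
  have small : ∫⁻ t in Set.Ioc (0 : ℝ) 1, ν {x | t < |x|} * ENNReal.ofReal (t ^ (q - 1))
      ≤ ENNReal.ofReal (1 / q) := by
    rw [← lintegral_Ioc_zero_one_rpow hq]
    exact lintegral_mono fun t ↦ mul_le_of_le_one_left zero_le prob_le_one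
  have large : ∫⁻ t in Set.Ioi (1 : ℝ), ν {x | t < |x|} * ENNReal.ofReal (t ^ (q - 1))
      ≤ ENNReal.ofReal C * ENNReal.ofReal (1 / (1 - q)) := by
    rw [← lintegral_Ioi_one_rpow hq1, ← lintegral_const_mul _ (by fun_prop)]
    refine setLIntegral_mono (by fun_prop) fun t ht ↦ ?_
    have ht0 : (0 : ℝ) < t := one_pos.trans ht
    rw [← ofReal_measureReal, ← ENNReal.ofReal_mul measureReal_nonneg, ← ENNReal.ofReal_mul hC]
    apply ENNReal.ofReal_le_ofReal
    calc ν.real {x | t < |x|} * t ^ (q - 1) ≤ C / t * t ^ (q - 1) := by gcongr; exact htail t ht0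
      _ = C * t ^ (q - 2) := by
        rw [show q - 2 = q - 1 - 1 by ring, Real.rpow_sub_one ht0.ne' (q - 1)]
        ring
  have : 0 < 1 - q := by linarith
  rw [lintegral_rpow_eq_lintegral_meas_lt_mul ν (ae_of_all _ fun x ↦ abs_nonneg x) (by fun_prop) hq,
    ← Set.Ioc_union_Ioi_eq_Ioi (zero_le_one' ℝ),
    lintegral_union measurableSet_Ioi (Set.Ioc_disjoint_Ioi le_rfl)]
  calc _ ≤ ENNReal.ofReal q *
        (ENNReal.ofReal (1 / q) + ENNReal.ofReal C * ENNReal.ofReal (1 / (1 - q))) := by gcongr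
    _ = ENNReal.ofReal (1 + C * q / (1 - q)) := by
      rw [← ENNReal.ofReal_mul hC, ← ENNReal.ofReal_add (by positivity) (by positivity),
        ← ENNReal.ofReal_mul hq.le]
      congr 1
      field_simp

/-- The absolute moment of order `1 / 4`. For `p`-stable laws with `p ≥ 1` the moment of twice that
order is finite too, so that empirical averages concentrate. -/
noncomputable def quarterMoment (ν : Measure ℝ) : ℝ := ∫ x, |x| ^ (1 / 4 : ℝ) ∂ν

lemma one_sub_cos_le_two_mul_rpow_quarter (x : ℝ) :
    1 - Real.cos x ≤ 2 * |x| ^ (1 / 4 : ℝ) := by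
  rcases le_total |x| 1 with hx | hx
  · have sq_le : |x| ^ (2 : ℝ) ≤ |x| ^ (1 / 4 : ℝ) :=
      Real.rpow_le_rpow_of_exponent_ge_of_imp (abs_nonneg x) hx (by norm_num) (by norm_num)
    rw [Real.rpow_two, sq_abs] at sq_le
    nlinarith [sq_nonneg x, Real.one_sub_sq_div_two_le_cos (x := x)]
  · linarith [Real.neg_one_le_cos x, Real.one_le_rpow hx (by norm_num : (0 : ℝ) ≤ 1 / 4)]

lemma rpow_inv_mul_abs_rpow {p a : ℝ} (ha : 0 ≤ a) (q x : ℝ) :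
    |a ^ p⁻¹ * x| ^ q = a ^ (q / p) * |x| ^ q := by
  rw [abs_mul, abs_of_nonneg (by positivity), Real.mul_rpow (by positivity) (abs_nonneg _),
    ← Real.rpow_mul ha, inv_mul_eq_div]

namespace IsStable

variable {p : ℝ} {ν : Measure ℝ}

lemma norm_one_sub_charFun_le (h : IsStable p ν) (hp : 1 ≤ p) {t : ℝ} (ht : |t| ≤ 1) :
    ‖1 - charFun ν t‖ ≤ |t| := by
  have rpow_le : |t| ^ p ≤ |t| ^ (1 : ℝ) :=
    Real.rpow_le_rpow_of_exponent_ge_of_imp (abs_nonneg t) ht hp (by grind)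
  have exp_le_one : Real.exp (-|t| ^ p) ≤ 1 :=
    Real.exp_le_one_iff.2 (neg_nonpos.2 (by positivity))
  rw [Real.rpow_one] at rpow_le
  rw [h t, ← Complex.ofReal_one, ← Complex.ofReal_sub, Complex.norm_real,
    Real.norm_of_nonneg (by linarith)]
  linarith [Real.add_one_le_exp (-|t| ^ p)]

variable [IsProbabilityMeasure ν]

lemma tail_le (h : IsStable p ν) (hp : 1 ≤ p) {r : ℝ} (hr : 0 < r) :
    ν.real {x | r < |x|} ≤ 4 / r := by
  rcases lt_or_ge r 2 with hr2 | hr2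
  · refine measureReal_le_one.trans ?_
    rw [le_div_iff₀ hr]
    linarith
  have hr_inv := inv_pos.2 hr
  have integral_le : ‖∫ t in (-2 * r⁻¹)..(2 * r⁻¹), 1 - charFun ν t‖
      ≤ 2 * r⁻¹ * |2 * r⁻¹ - (-2 * r⁻¹)| := by
    refine intervalIntegral.norm_integral_le_of_norm_le_const fun t ht ↦ ?_
    rw [Set.uIoc_of_le (by linarith)] at ht
    have abs_le : |t| ≤ 2 * r⁻¹ := abs_le.2 ⟨by linarith [ht.1], ht.2⟩
    have le_one : 2 * r⁻¹ ≤ 1 := by rwa [← div_eq_mul_inv, div_le_one hr]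
    exact (h.norm_one_sub_charFun_le hp (abs_le.trans le_one)).trans abs_le
  rw [abs_of_nonneg (by linarith)] at integral_le
  calc ν.real {x | r < |x|}
      ≤ 2⁻¹ * r * ‖∫ t in (-2 * r⁻¹)..(2 * r⁻¹), 1 - charFun ν t‖ :=
        measureReal_abs_gt_le_integral_charFun hr
    _ ≤ 2⁻¹ * r * (2 * r⁻¹ * (2 * r⁻¹ - (-2 * r⁻¹))) := by gcongr
    _ = 4 / r := by field_simp; ring

lemma lintegral_abs_rpow_le (h : IsStable p ν) (hp : 1 ≤ p) {q : ℝ} (hq : 0 < q) (hq1 : q < 1) :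
    ∫⁻ x, ENNReal.ofReal (|x| ^ q) ∂ν ≤ ENNReal.ofReal (1 + 4 * q / (1 - q)) :=
  lintegral_abs_rpow_le_of_tail_le (by norm_num) (fun _ ↦ h.tail_le hp) hq hq1

lemma integrable_abs_rpow (h : IsStable p ν) (hp : 1 ≤ p) {q : ℝ} (hq : 0 < q) (hq1 : q < 1) :
    Integrable (fun x ↦ |x| ^ q) ν := by
  refine ⟨(measurable_abs_rpow q).aestronglyMeasurable, ?_⟩
  rw [hasFiniteIntegral_iff_ofReal (ae_of_all _ fun x ↦ by positivity)]
  exact (h.lintegral_abs_rpow_le hp hq hq1).trans_lt ENNReal.ofReal_lt_top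

lemma integral_abs_rpow_le (h : IsStable p ν) (hp : 1 ≤ p) {q : ℝ} (hq : 0 < q) (hq1 : q < 1) :
    ∫ x, |x| ^ q ∂ν ≤ 1 + 4 * q / (1 - q) := by
  have : 0 < 1 - q := by linarith
  rw [integral_eq_lintegral_of_nonneg_ae (ae_of_all _ fun x ↦ by positivity)
    (measurable_abs_rpow q).aestronglyMeasurable]
  exact ENNReal.toReal_le_of_le_ofReal (by positivity) (h.lintegral_abs_rpow_le hp hq hq1)

lemma quarterMoment_le (h : IsStable p ν) (hp : 1 ≤ p) : quarterMoment ν ≤ 3 :=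
  (h.integral_abs_rpow_le hp (by norm_num) (by norm_num)).trans (by norm_num)

lemma integral_cos (h : IsStable p ν) : ∫ x, Real.cos x ∂ν = Real.exp (-1) := by
  have re_charFun := congrArg Complex.re (h 1)
  have integrable : Integrable (fun x : ℝ ↦ Complex.exp ((1 : ℝ) * x * Complex.I)) ν := by
    refine Integrable.of_bound (by fun_prop) 1 (ae_of_all _ fun x ↦ ?_)
    rw [← Complex.ofReal_mul, Complex.norm_exp_ofReal_mul_I]
  rw [charFun_apply_real, ← RCLike.re_eq_complex_re, ← integral_re integrable] at re_charFun
  simpa only [Complex.ofReal_one, one_mul, RCLike.re_eq_complex_re, Complex.exp_ofReal_mul_I_re,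
    abs_one, Real.one_rpow, Complex.ofReal_re] using re_charFun

lemma le_quarterMoment (h : IsStable p ν) (hp : 1 ≤ p) : 1 / 4 ≤ quarterMoment ν := by
  have integrable_cos : Integrable Real.cos ν :=
    Integrable.of_bound (by fun_prop) 1 (ae_of_all _ fun x ↦ Real.abs_cos_le_one x)
  have integral_le : ∫ x, (1 - Real.cos x) ∂ν ≤ ∫ x, 2 * |x| ^ (1 / 4 : ℝ) ∂ν :=
    integral_mono ((integrable_const 1).sub integrable_cos)
      ((h.integrable_abs_rpow hp (by norm_num) (by norm_num)).const_mul 2)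
      one_sub_cos_le_two_mul_rpow_quarter
  rw [integral_sub (integrable_const 1) integrable_cos, h.integral_cos, integral_const_mul,
    integral_const, probReal_univ, smul_eq_mul, mul_one] at integral_le
  unfold quarterMoment
  linarith [Real.exp_neg_one_lt_half]

variable {ι : Type*} [Fintype ι]

theorem map_pi_sum_mul (h : IsStable p ν) (hp : 0 < p) (y : ι → ℝ) :
    (Measure.pi fun _ : ι ↦ ν).map (fun z ↦ ∑ j, z j * y j)
      = ν.map (fun x ↦ (∑ j, |y j| ^ p) ^ p⁻¹ * x) := by
  have : IsProbabilityMeasure ((Measure.pi fun _ : ι ↦ ν).map (fun z ↦ ∑ j, z j * y j)) :=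
    Measure.isProbabilityMeasure_map (measurable_sum_mul y).aemeasurable
  have : IsProbabilityMeasure (ν.map (fun x ↦ (∑ j, |y j| ^ p) ^ p⁻¹ * x)) :=
    Measure.isProbabilityMeasure_map (by fun_prop)
  refine Measure.ext_of_charFun (funext fun t ↦ ?_)
  have exp_eq_prod (z : ι → ℝ) : Complex.exp (t * (∑ j, z j * y j : ℝ) * Complex.I)
      = ∏ j, Complex.exp ((t * y j : ℝ) * z j * Complex.I) := by
    rw [← Complex.exp_sum]
    congr 1
    push_cast
    rw [Finset.mul_sum, Finset.sum_mul]
    exact Finset.sum_congr rfl fun j _ ↦ by ring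
  have exponent : |(∑ j, |y j| ^ p) ^ p⁻¹ * t| ^ p = ∑ j, |t * y j| ^ p := by
    rw [rpow_inv_mul_abs_rpow (by positivity), div_self hp.ne', Real.rpow_one, Finset.sum_mul]
    refine Finset.sum_congr rfl fun j _ ↦ ?_
    rw [abs_mul, Real.mul_rpow (abs_nonneg _) (abs_nonneg _), mul_comm]
  rw [charFun_map_mul, h, exponent, charFun_apply_real,
    integral_map (measurable_sum_mul y).aemeasurable (by fun_prop)]
  simp_rw [exp_eq_prod]
  rw [integral_fintype_prod_eq_prod (fun j (x : ℝ) ↦ Complex.exp ((t * y j : ℝ) * x * Complex.I))]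
  simp_rw [← charFun_apply_real, h _]
  rw [← Complex.ofReal_prod, ← Real.exp_sum, Finset.sum_neg_distrib]

lemma integral_pi_abs_rpow (h : IsStable p ν) (hp : 0 < p) (y : ι → ℝ) (q : ℝ) :
    ∫ z, |∑ j, z j * y j| ^ q ∂(Measure.pi fun _ : ι ↦ ν)
      = (∑ j, |y j| ^ p) ^ (q / p) * ∫ x, |x| ^ q ∂ν := by
  have meas := measurable_abs_rpow q
  rw [← integral_map (f := fun x ↦ |x| ^ q) (measurable_sum_mul y).aemeasurable
    meas.aestronglyMeasurable, h.map_pi_sum_mul hp,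
    integral_map (by fun_prop) meas.aestronglyMeasurable, ← integral_const_mul]
  simp_rw [rpow_inv_mul_abs_rpow (show 0 ≤ ∑ j, |y j| ^ p by positivity)]

lemma integrable_pi_abs_rpow (h : IsStable p ν) (hp : 0 < p) (y : ι → ℝ) {q : ℝ}
    (hq : Integrable (fun x ↦ |x| ^ q) ν) :
    Integrable (fun z ↦ |∑ j, z j * y j| ^ q) (Measure.pi fun _ : ι ↦ ν) := by
  refine Integrable.comp_measurable (g := fun x ↦ |x| ^ q) ?_ (measurable_sum_mul y)
  rw [h.map_pi_sum_mul hp,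
    integrable_map_measure (measurable_abs_rpow q).aestronglyMeasurable (by fun_prop)]
  refine (hq.const_mul ((∑ j, |y j| ^ p) ^ (q / p))).congr (ae_of_all _ fun x ↦ ?_)
  exact (rpow_inv_mul_abs_rpow (by positivity) q x).symm

end IsStable

/-! ### Random signs and square functions -/

lemma sum_rpow_le_card_mul_rpow {S : Type*} [Fintype S] {f : S → ℝ} (hf : ∀ s, 0 ≤ f s)
    {σ L : ℝ} (hσ : 0 ≤ σ) (hσ1 : σ ≤ 1) (hL : ∑ s, f s ≤ Fintype.card S * L) :
    ∑ s, f s ^ σ ≤ Fintype.card S * L ^ σ := by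
  rcases isEmpty_or_nonempty S with _ | _
  · simp
  set N : ℝ := (Fintype.card S : ℝ) with hN
  have N_pos : 0 < N := by simp only [hN, Nat.cast_pos, Fintype.card_pos]
  have weights : ∑ _s : S, N⁻¹ = 1 := by simp [hN]
  have jensen : ∑ s, N⁻¹ * f s ^ σ ≤ (∑ s, N⁻¹ * f s) ^ σ := by
    simpa using (Real.concaveOn_rpow hσ hσ1).le_map_sum (t := Finset.univ) (w := fun _ ↦ N⁻¹)
      (p := f) (fun _ _ ↦ by positivity) weights (fun s _ ↦ hf s)
  rw [← Finset.mul_sum, ← Finset.mul_sum, inv_mul_eq_div, inv_mul_eq_div,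
    div_le_iff₀' N_pos] at jensen
  refine jensen.trans (mul_le_mul_of_nonneg_left ?_ N_pos.le)
  exact Real.rpow_le_rpow (div_nonneg (Finset.sum_nonneg fun s _ ↦ hf s) N_pos.le)
    ((div_le_iff₀' N_pos).2 hL) hσ

lemma rpow_sum_le_sum_rpow {ι : Type*} (t : Finset ι) {f : ι → ℝ} (hf : ∀ i, 0 ≤ f i) {σ : ℝ}
    (hσ : 0 < σ) (hσ1 : σ ≤ 1) : (∑ i ∈ t, f i) ^ σ ≤ ∑ i ∈ t, f i ^ σ := by
  classical
  induction t using Finset.induction_on with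
  | empty => simp [Real.zero_rpow hσ.ne']
  | insert i t hi ih =>
    rw [Finset.sum_insert hi, Finset.sum_insert hi]
    exact (Real.rpow_add_le_add_rpow (hf i) (Finset.sum_nonneg fun j _ ↦ hf j) hσ.le hσ1).trans
      (by gcongr)

lemma abs_rpow_eq_sq_rpow_half (r p : ℝ) : |r| ^ p = (r ^ 2) ^ (p / 2) := by
  rw [← sq_abs, ← Real.rpow_two, ← Real.rpow_mul (abs_nonneg r)]
  congr 1
  ring

section signSum

variable {m : ℕ}

/-- The sum of the numbers `a v` with the signs prescribed by `s`; averages over `s` play the role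
of expectations over independent random signs. -/
def signSum (a : Fin m → ℝ) (s : Fin m → Bool) : ℝ :=
  ∑ v, (if s v then 1 else -1) * a v

lemma card_signs : (Fintype.card (Fin m → Bool) : ℝ) = 2 ^ m := by simp

lemma sum_comp_signSum_succ (a : Fin (m + 1) → ℝ) (f : ℝ → ℝ) :
    ∑ s, f (signSum a s) = ∑ s, (f (a 0 + signSum (Fin.tail a) s)
      + f (-a 0 + signSum (Fin.tail a) s)) := by
  rw [← (Fin.consEquiv fun _ ↦ Bool).sum_comp, Fintype.sum_prod_type, Fintype.sum_bool,
    ← Finset.sum_add_distrib]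
  refine Finset.sum_congr rfl fun s _ ↦ ?_
  simp [signSum, Fin.consEquiv, Fin.sum_univ_succ, Fin.tail]

lemma sum_signSum_sq (a : Fin m → ℝ) : ∑ s, signSum a s ^ 2 = 2 ^ m * ∑ v, a v ^ 2 := by
  induction m with
  | zero => simp [signSum]
  | succ m ih =>
    calc _ = ∑ s, (2 * a 0 ^ 2 + 2 * signSum (Fin.tail a) s ^ 2) := by
          rw [sum_comp_signSum_succ a (· ^ 2)]
          exact Finset.sum_congr rfl fun s _ ↦ by ring
      _ = 2 ^ m * (2 * a 0 ^ 2) + 2 * (2 ^ m * ∑ v, Fin.tail a v ^ 2) := by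
          rw [Finset.sum_add_distrib, ← Finset.mul_sum Finset.univ (fun s ↦ signSum _ s ^ 2),
            ih (Fin.tail a)]
          simp
      _ = 2 ^ (m + 1) * ∑ v, a v ^ 2 := by
          rw [Fin.sum_univ_succ]
          simp only [Fin.tail]
          ring

lemma sum_signSum_pow_four_le (a : Fin m → ℝ) :
    ∑ s, signSum a s ^ 4 ≤ 3 * 2 ^ m * (∑ v, a v ^ 2) ^ 2 := by
  induction m with
  | zero => simp [signSum]
  | succ m ih =>
    set Q := ∑ v, Fin.tail a v ^ 2
    calc _ = ∑ s, (2 * a 0 ^ 4 + 12 * a 0 ^ 2 * signSum (Fin.tail a) s ^ 2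
            + 2 * signSum (Fin.tail a) s ^ 4) := by
          rw [sum_comp_signSum_succ a (· ^ 4)]
          exact Finset.sum_congr rfl fun s _ ↦ by ring
      _ = 2 ^ m * (2 * a 0 ^ 4) + 12 * a 0 ^ 2 * (2 ^ m * Q)
            + 2 * ∑ s, signSum (Fin.tail a) s ^ 4 := by
          simp only [Finset.sum_add_distrib, ← Finset.mul_sum, sum_signSum_sq (Fin.tail a)]
          simp [Q]
          ring
      _ ≤ 2 ^ m * (6 * a 0 ^ 4) + 12 * a 0 ^ 2 * (2 ^ m * Q) + 2 * (3 * 2 ^ m * Q ^ 2) := by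
          gcongr
          · norm_num
          · exact ih (Fin.tail a)
      _ = 3 * 2 ^ (m + 1) * (a 0 ^ 2 + Q) ^ 2 := by ring
      _ = 3 * 2 ^ (m + 1) * (∑ v, a v ^ 2) ^ 2 := by rw [Fin.sum_univ_succ]; rfl

lemma sub_sq_div_four_le_rpow {x q : ℝ} (hx : 0 ≤ x) (hq : 0 ≤ q) (hq1 : q ≤ 1) :
    x - x ^ 2 / 4 ≤ x ^ q := by
  rcases hx.eq_or_lt with rfl | hx
  · simpa using Real.rpow_nonneg le_rfl q
  rcases le_total x 1 with hx1 | hx1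
  · have := Real.rpow_le_rpow_of_exponent_ge hx hx1 hq1
    rw [Real.rpow_one] at this
    nlinarith [sq_nonneg x]
  · nlinarith [Real.one_le_rpow hx1 hq, sq_nonneg (x - 2)]

-- The second and fourth moments of `signSum a` are compared through `x - x² / 4 ≤ x ^ (q / 2)`.
theorem rpow_sum_sq_le_sum_signSum (a : Fin m → ℝ) {q : ℝ} (hq : 0 < q) (hq2 : q ≤ 2) :
    (∑ v, a v ^ 2) ^ (q / 2) ≤ 4 / 2 ^ m * ∑ s, |signSum a s| ^ q := by
  set Q := ∑ v, a v ^ 2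
  have Q_nonneg : 0 ≤ Q := Finset.sum_nonneg fun v _ ↦ sq_nonneg _
  rcases Q_nonneg.eq_or_lt with Q_zero | Q_pos
  · rw [← Q_zero, Real.zero_rpow (by positivity)]
    positivity
  have pointwise (r : ℝ) :
      Q ^ (q / 2) * (r ^ 2 / Q - (r ^ 2 / Q) ^ 2 / 4) ≤ |r| ^ q :=
    calc _ ≤ Q ^ (q / 2) * (r ^ 2 / Q) ^ (q / 2) := by
          gcongr
          exact sub_sq_div_four_le_rpow (by positivity) (by positivity) (by linarith)
      _ = |r| ^ q := by
          rw [← Real.mul_rpow Q_nonneg (by positivity), mul_div_cancel₀ _ Q_pos.ne',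
            abs_rpow_eq_sq_rpow_half]
  have second_moment : ∑ s, signSum a s ^ 2 / Q = 2 ^ m := by
    rw [← Finset.sum_div, sum_signSum_sq, mul_div_cancel_right₀ _ Q_pos.ne']
  have fourth_moment : ∑ s, (signSum a s ^ 2 / Q) ^ 2 ≤ 3 * 2 ^ m := by
    simp only [div_pow, ← pow_mul]
    rw [← Finset.sum_div, div_le_iff₀ (by positivity)]
    exact sum_signSum_pow_four_le a
  have scaled : Q ^ (q / 2) * (2 ^ m / 4) ≤ ∑ s, |signSum a s| ^ q := by
    calc _ ≤ Q ^ (q / 2) * (∑ s, signSum a s ^ 2 / Q - (∑ s, (signSum a s ^ 2 / Q) ^ 2) / 4) := by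
          gcongr
          linarith
      _ = ∑ s, Q ^ (q / 2) * (signSum a s ^ 2 / Q - (signSum a s ^ 2 / Q) ^ 2 / 4) := by
          rw [← Finset.mul_sum, Finset.sum_sub_distrib, Finset.sum_div _ _ (4 : ℝ)]
      _ ≤ _ := Finset.sum_le_sum fun s _ ↦ pointwise _
  rw [div_mul_eq_mul_div, le_div_iff₀ (by positivity)]
  linarith

lemma sum_abs_signSum_rpow_le (a : Fin m → ℝ) {p : ℝ} (hp : 0 < p) (hp2 : p ≤ 2) :
    ∑ s, |signSum a s| ^ p ≤ 2 ^ m * ∑ v, |a v| ^ p := by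
  simp_rw [abs_rpow_eq_sq_rpow_half _ p]
  have second_moment : ∑ s, signSum a s ^ 2 ≤ Fintype.card (Fin m → Bool) * ∑ v, a v ^ 2 := by
    rw [sum_signSum_sq, card_signs]
  have jensen := sum_rpow_le_card_mul_rpow (fun s ↦ sq_nonneg (signSum a s))
    (half_pos hp).le (by linarith) second_moment
  rw [card_signs] at jensen
  refine jensen.trans (mul_le_mul_of_nonneg_left ?_ (by positivity))
  exact rpow_sum_le_sum_rpow _ (fun v ↦ sq_nonneg (a v)) (half_pos hp) (by linarith)

lemma signSum_sum_mul {ι : Type*} [Fintype ι] (z : ι → ℝ) (x : Fin m → ι → ℝ)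
    (s : Fin m → Bool) :
    signSum (fun v ↦ ∑ j, z j * x v j) s = ∑ j, z j * signSum (fun v ↦ x v j) s := by
  simp only [signSum, Finset.mul_sum]
  rw [Finset.sum_comm]
  exact Finset.sum_congr rfl fun j _ ↦ Finset.sum_congr rfl fun v _ ↦ by ring

lemma sum_rpow_sum_abs_signSum_le {ι : Type*} [Fintype ι] (x : Fin m → ι → ℝ) {p σ : ℝ}
    (hp : 0 < p) (hp2 : p ≤ 2) (hσ : 0 ≤ σ) (hσ1 : σ ≤ 1) :
    ∑ s, (∑ j, |signSum (fun v ↦ x v j) s| ^ p) ^ σ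
      ≤ 2 ^ m * (∑ v, ∑ j, |x v j| ^ p) ^ σ := by
  have mean_le : ∑ s, ∑ j, |signSum (fun v ↦ x v j) s| ^ p
      ≤ Fintype.card (Fin m → Bool) * ∑ v, ∑ j, |x v j| ^ p := by
    rw [card_signs, Finset.sum_comm, Finset.sum_comm (f := fun v j ↦ |x v j| ^ p), Finset.mul_sum]
    exact Finset.sum_le_sum fun j _ ↦ sum_abs_signSum_rpow_le _ hp hp2
  have jensen := sum_rpow_le_card_mul_rpow (fun s ↦ by positivity) hσ hσ1 mean_le
  rwa [card_signs] at jensen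

theorem IsStable.lintegral_sum_sq_le {p : ℝ} {ν : Measure ℝ} [IsProbabilityMeasure ν]
    (h : IsStable p ν) (hp : 1 ≤ p) (hp2 : p ≤ 2) {ι : Type*} [Fintype ι] (x : Fin m → ι → ℝ) :
    ∫⁻ z, ENNReal.ofReal ((∑ v, (∑ j, z j * x v j) ^ 2) ^ (1 / 8 : ℝ))
        ∂(Measure.pi fun _ : ι ↦ ν)
      ≤ ENNReal.ofReal (4 * quarterMoment ν * (∑ v, ∑ j, |x v j| ^ p) ^ (1 / 4 / p)) := by
  have hp0 : 0 < p := by linarith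
  have integrable (s : Fin m → Bool) := h.integrable_pi_abs_rpow hp0
    (fun j ↦ signSum (fun v ↦ x v j) s)
    (h.integrable_abs_rpow hp (q := 1 / 4) (by norm_num) (by norm_num))
  have moment_nonneg : 0 ≤ quarterMoment ν := by linarith [h.le_quarterMoment hp]
  calc _ ≤ ∫⁻ z, ENNReal.ofReal (4 / 2 ^ m *
          ∑ s, |∑ j, z j * signSum (fun v ↦ x v j) s| ^ (1 / 4 : ℝ))
          ∂(Measure.pi fun _ : ι ↦ ν) := by
        refine lintegral_mono fun z ↦ ENNReal.ofReal_le_ofReal ?_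
        have khintchine := rpow_sum_sq_le_sum_signSum (fun v ↦ ∑ j, z j * x v j)
          (q := 1 / 4) (by norm_num) (by norm_num)
        simp_rw [signSum_sum_mul] at khintchine
        convert khintchine using 2
        norm_num
    _ = ENNReal.ofReal (4 / 2 ^ m * ∑ s,
          (∑ j, |signSum (fun v ↦ x v j) s| ^ p) ^ (1 / 4 / p) * quarterMoment ν) := by
        rw [← ofReal_integral_eq_lintegral_ofReal
          ((integrable_finsetSum _ fun s _ ↦ integrable s).const_mul _)
          (ae_of_all _ fun z ↦ by positivity), integral_const_mul,
          integral_finsetSum _ fun s _ ↦ integrable s]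
        simp_rw [h.integral_pi_abs_rpow hp0]
        rfl
    _ ≤ _ := by
        apply ENNReal.ofReal_le_ofReal
        rw [← Finset.sum_mul]
        calc _ ≤ 4 / 2 ^ m * (2 ^ m * (∑ v, ∑ j, |x v j| ^ p) ^ (1 / 4 / p)
                * quarterMoment ν) := by
              gcongr
              exact sum_rpow_sum_abs_signSum_le x hp0 hp2 (by positivity)
                (by rw [div_le_one hp0]; linarith)
          _ = _ := by field_simp

end signSum

/-! ### Unbiased floating point rounding -/

/-- The binary exponent of `y`, cut off from below at `-A`. -/
noncomputable def expo (A : ℕ) (y : ℝ) : ℤ := max ⌊Real.logb 2 |y|⌋ (-A)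

/-- The spacing of the floating point numbers with `b` bits of mantissa near `y`. -/
noncomputable def spacing (A b : ℕ) (y : ℝ) : ℝ := 2 ^ (expo A y - b)

/-- Floating point rounding of `y` with shift `u`, which is unbiased for uniformly distributed `u`.
Reducing `u` modulo `1` makes the rounding error bounded for every `u`. -/
noncomputable def fround (A b : ℕ) (y u : ℝ) : ℝ :=
  spacing A b y * ⌊y / spacing A b y + Int.fract u⌋

/-- The uniform distribution on the unit interval, as a measure on `ℝ`. -/
noncomputable def unif : Measure ℝ := volume.restrict (Set.Ico 0 1)

instance : IsProbabilityMeasure unif := ⟨by simp [unif]⟩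

section fround

variable {A b : ℕ} {y u : ℝ}

lemma spacing_pos : 0 < spacing A b y := by unfold spacing; positivity

@[simp] lemma fround_zero : fround A b 0 u = 0 := by
  simp [fround]

lemma abs_lt_two_zpow_expo : |y| < 2 ^ (expo A y + 1) := by
  rcases eq_or_ne y 0 with rfl | hy
  · simp only [abs_zero]
    positivity
  rw [← Real.rpow_intCast, ← Real.logb_lt_iff_lt_rpow one_lt_two (abs_pos.2 hy)]
  refine (Int.lt_floor_add_one _).trans_le ?_
  push_cast
  gcongr
  exact_mod_cast le_max_left _ _

lemma two_zpow_floor_logb_le (hy : y ≠ 0) : (2 : ℝ) ^ ⌊Real.logb 2 |y|⌋ ≤ |y| := by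
  rw [← Real.rpow_intCast, ← Real.le_logb_iff_rpow_le one_lt_two (abs_pos.2 hy)]
  exact Int.floor_le _

lemma sq_two_zpow_expo_le (hy : y ≠ 0) : ((2 : ℝ) ^ expo A y) ^ 2 ≤ y ^ 2 + (1 / 4) ^ A := by
  rcases le_total ⌊Real.logb 2 |y|⌋ (-A : ℤ) with h | h
  · have cutoff : ((2 : ℝ) ^ (-A : ℤ)) ^ 2 = (1 / 4) ^ A := by
      rw [zpow_neg, zpow_natCast, ← inv_pow, ← pow_mul, mul_comm, pow_mul]
      norm_num
    rw [expo, max_eq_right h, cutoff]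
    exact le_add_of_nonneg_left (sq_nonneg y)
  · rw [expo, max_eq_left h, ← sq_abs y]
    refine le_add_of_le_of_nonneg ?_ (by positivity)
    gcongr
    exact two_zpow_floor_logb_le hy

lemma sq_spacing_le (hy : y ≠ 0) : spacing A b y ^ 2 ≤ (1 / 4) ^ b * (y ^ 2 + (1 / 4) ^ A) := by
  have sq_spacing : spacing A b y ^ 2 = (1 / 4) ^ b * ((2 : ℝ) ^ expo A y) ^ 2 := by
    rw [spacing, zpow_sub₀ two_ne_zero, zpow_natCast, div_pow, ← pow_mul, mul_comm b, pow_mul,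
      div_eq_inv_mul, ← inv_pow]
    norm_num
  rw [sq_spacing]
  gcongr
  exact sq_two_zpow_expo_le hy

lemma abs_fround_sub_le : |fround A b y u - y| ≤ spacing A b y := by
  have s_pos := spacing_pos (A := A) (b := b) (y := y)
  set s := spacing A b y
  have factor : fround A b y u - y = s * (⌊y / s + Int.fract u⌋ - y / s) := by
    unfold fround
    rw [mul_sub, mul_div_cancel₀ _ s_pos.ne']
  rw [factor, abs_mul, abs_of_pos s_pos]
  refine mul_le_of_le_one_right s_pos.le (abs_le.2 ⟨?_, ?_⟩)
  · linarith [Int.lt_floor_add_one (y / s + Int.fract u), Int.fract_nonneg u]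
  · linarith [Int.floor_le (y / s + Int.fract u), Int.fract_lt_one u]

lemma sq_fround_sub_le : (fround A b y u - y) ^ 2 ≤ (1 / 4) ^ b * (y ^ 2 + (1 / 4) ^ A) := by
  rcases eq_or_ne y 0 with rfl | hy
  · rw [fround_zero, sub_self, zero_pow two_ne_zero]
    positivity
  calc (fround A b y u - y) ^ 2 = |fround A b y u - y| ^ 2 := (sq_abs _).symm
    _ ≤ spacing A b y ^ 2 := by gcongr; exact abs_fround_sub_le
    _ ≤ _ := sq_spacing_le hy

lemma measurable_spacing (A b : ℕ) : Measurable (spacing A b) := by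
  have measurable_expo : Measurable (expo A) := by
    have : Measurable fun y : ℝ ↦ Real.logb 2 |y| := by unfold Real.logb; fun_prop
    exact (Int.measurable_floor.comp this).max measurable_const
  exact (measurable_from_top (f := fun k : ℤ ↦ (2 : ℝ) ^ (k - b))).comp measurable_expo

lemma measurable_fround (A b : ℕ) : Measurable fun x : ℝ × ℝ ↦ fround A b x.1 x.2 := by
  have meas_spacing : Measurable fun x : ℝ × ℝ ↦ spacing A b x.1 :=
    (measurable_spacing A b).comp measurable_fst
  have meas_shifted : Measurable fun x : ℝ × ℝ ↦ x.1 / spacing A b x.1 + Int.fract x.2 :=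
    (measurable_fst.div meas_spacing).add (measurable_fract.comp measurable_snd)
  exact meas_spacing.mul ((measurable_from_top (f := fun k : ℤ ↦ (k : ℝ))).comp
    (Int.measurable_floor.comp meas_shifted))

lemma floor_add_eq_floor_add_indicator (x : ℝ) (hu : u ∈ Set.Ico (0 : ℝ) 1) :
    (⌊x + u⌋ : ℝ) = ⌊x⌋ + (Set.Ici (1 - Int.fract x)).indicator (fun _ ↦ (1 : ℝ)) u := by
  have floor_add_fract := Int.floor_add_fract x
  have fract_nonneg := Int.fract_nonneg x
  have fract_lt_one := Int.fract_lt_one x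
  by_cases carry : 1 - Int.fract x ≤ u
  · have floor_eq : ⌊x + u⌋ = ⌊x⌋ + 1 := by
      rw [Int.floor_eq_iff]
      push_cast
      constructor <;> linarith [hu.2]
    simp [floor_eq, carry]
  · have floor_eq : ⌊x + u⌋ = ⌊x⌋ := by
      rw [Int.floor_eq_iff]
      constructor <;> linarith [hu.1]
    simp [floor_eq, carry]

lemma integral_floor_add_fract (x : ℝ) : ∫ u, (⌊x + Int.fract u⌋ : ℝ) ∂unif = x := by
  have fract_nonneg := Int.fract_nonneg x
  have carry_set : Set.Ico (0 : ℝ) 1 ∩ Set.Ici (1 - Int.fract x) = Set.Ico (1 - Int.fract x) 1 := by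
    ext u
    simp only [Set.mem_inter_iff, Set.mem_Ico, Set.mem_Ici]
    grind [Int.fract_lt_one x]
  calc ∫ u, (⌊x + Int.fract u⌋ : ℝ) ∂unif
      = ∫ u in Set.Ico (0 : ℝ) 1, ((⌊x⌋ : ℝ) +
          (Set.Ici (1 - Int.fract x)).indicator (fun _ ↦ (1 : ℝ)) u) :=
        setIntegral_congr_fun measurableSet_Ico fun u hu ↦ by
          simp only [Int.fract_eq_self.2 hu, floor_add_eq_floor_add_indicator x hu]
    _ = ⌊x⌋ + Int.fract x := by
        rw [integral_add (by simp) ((integrable_const (1 : ℝ)).indicator measurableSet_Ici),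
          setIntegral_indicator measurableSet_Ici, carry_set]
        simp [fract_nonneg]
    _ = x := Int.floor_add_fract x

lemma integral_fround_sub (A b : ℕ) (y : ℝ) : ∫ u, (fround A b y u - y) ∂unif = 0 := by
  have integrable : Integrable (fun u ↦ fround A b y u) unif := by
    refine Integrable.of_bound ((measurable_fround A b).comp
      (measurable_const.prodMk measurable_id)).aestronglyMeasurable (|y| + spacing A b y)
      (ae_of_all _ fun u ↦ ?_)
    rw [Real.norm_eq_abs]
    linarith [abs_fround_sub_le (A := A) (b := b) (y := y) (u := u),
      abs_sub_abs_le_abs_sub (fround A b y u) y]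
  rw [integral_sub integrable (by simp)]
  simp only [fround]
  rw [integral_const_mul, integral_floor_add_fract, mul_div_cancel₀ _ spacing_pos.ne']
  simp

end fround

/-- The floating point numbers with exponent between `-A` and `A'` and `b` bits of mantissa. The
mantissas reach one beyond `2 ^ (b + 1)` because rounding may carry. -/
noncomputable def grid (A A' b : ℕ) : Finset ℝ :=
  (Finset.Icc (-A : ℤ) A' ×ˢ Finset.Icc (-(2 ^ (b + 1) + 1) : ℤ) (2 ^ (b + 1) + 1)).image
    fun x ↦ (2 : ℝ) ^ (x.1 - b : ℤ) * x.2

section grid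

variable {A A' b : ℕ} {y u : ℝ}

lemma card_grid_le (A A' b : ℕ) : (grid A A' b).card ≤ (A + A' + 1) * 2 ^ (b + 3) := by
  refine Finset.card_image_le.trans ?_
  rw [Finset.card_product, Int.card_Icc, Int.card_Icc]
  have card_exponents : ((A' : ℤ) + 1 - -A).toNat = A + A' + 1 := by omega
  have card_mantissas : ((2 : ℤ) ^ (b + 1) + 1 + 1 - -(2 ^ (b + 1) + 1)).toNat ≤ 2 ^ (b + 3) := by
    have : (1 : ℤ) ≤ 2 ^ b := by exact_mod_cast Nat.one_le_two_pow
    rw [Int.toNat_le]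
    push_cast
    rw [pow_add 2 b 1, pow_add 2 b 3]
    linarith
  rw [card_exponents]
  gcongr

lemma zero_mem_grid (A A' b : ℕ) : (0 : ℝ) ∈ grid A A' b := by
  refine Finset.mem_image.2 ⟨(0, 0), ?_, by simp⟩
  have : (0 : ℤ) ≤ 2 ^ (b + 1) := by positivity
  simp only [Finset.mem_product, Finset.mem_Icc]
  omega

lemma expo_le (hy : |y| ≤ 2 ^ A') : expo A y ≤ A' := by
  refine max_le ?_ (by omega)
  rcases eq_or_ne y 0 with rfl | hy0
  · simp
  rw [← Int.cast_le (R := ℝ)]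
  refine (Int.floor_le _).trans ?_
  rw [Real.logb_le_iff_le_rpow one_lt_two (abs_pos.2 hy0)]
  push_cast
  rwa [Real.rpow_natCast]

lemma abs_div_spacing_lt : |y / spacing A b y| < 2 ^ (b + 1) := by
  have s_pos := spacing_pos (A := A) (b := b) (y := y)
  rw [abs_div, abs_of_pos s_pos, div_lt_iff₀ s_pos]
  refine (abs_lt_two_zpow_expo (A := A)).trans_le (le_of_eq ?_)
  rw [spacing, ← zpow_natCast, ← zpow_add₀ two_ne_zero]
  congr 1
  push_cast
  ring

lemma fround_mem_grid (hy : |y| ≤ 2 ^ A') : fround A b y u ∈ grid A A' b := by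
  refine Finset.mem_image.2 ⟨(expo A y, ⌊y / spacing A b y + Int.fract u⌋), ?_, rfl⟩
  rw [Finset.mem_product, Finset.mem_Icc, Finset.mem_Icc]
  have mantissa_bounds := abs_lt.1 (abs_div_spacing_lt (A := A) (b := b) (y := y))
  refine ⟨⟨le_max_right _ _, expo_le hy⟩, ?_, Int.le_of_lt_add_one (Int.floor_lt.2 ?_)⟩
  · rw [Int.le_floor]
    push_cast
    linarith [Int.fract_nonneg u]
  · push_cast
    linarith [Int.fract_lt_one u]

end grid

/-! ### Rooted trees -/

/-- A rooted tree on the vertex set `V`, given by its parent map and the distances to the root. The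
value of `parent` at the root is irrelevant. -/
structure Rooting (V : Type*) where
  root : V
  parent : V → V
  depth : V → ℕ
  depth_eq_zero : ∀ v, depth v = 0 ↔ v = root
  depth_parent : ∀ v, v ≠ root → depth (parent v) + 1 = depth v

namespace Rooting

variable {V : Type*} (T : Rooting V)

/-- `w` is a child of `v`. -/
def IsChild (w v : V) : Prop := T.depth w = T.depth v + 1 ∧ T.parent w = v

/-- `u` is a descendant of `v`, possibly `v` itself. -/
def Desc (u v : V) : Prop :=
  T.depth v ≤ T.depth u ∧ T.parent^[T.depth u - T.depth v] u = v

instance [DecidableEq V] (w v : V) : Decidable (T.IsChild w v) :=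
  inferInstanceAs (Decidable (_ ∧ _))

instance [DecidableEq V] (w v : V) : Decidable (T.Desc w v) := inferInstanceAs (Decidable (_ ∧ _))

lemma depth_iterate_parent (u : V) {k : ℕ} (hk : k ≤ T.depth u) :
    T.depth (T.parent^[k] u) + k = T.depth u := by
  induction k with
  | zero => simp
  | succ k ih =>
    have depth_k := ih (by omega)
    have ne_root : T.parent^[k] u ≠ T.root := fun h ↦ by
      have := (T.depth_eq_zero _).2 h
      omega
    have := T.depth_parent _ ne_root
    rw [Function.iterate_succ_apply']
    omega

lemma desc_self (v : V) : T.Desc v v := by simp [Desc]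

lemma desc_root (u : V) : T.Desc u T.root := by
  have depth_root := (T.depth_eq_zero T.root).2 rfl
  refine ⟨by omega, ?_⟩
  rw [depth_root, Nat.sub_zero, ← T.depth_eq_zero]
  have := T.depth_iterate_parent u le_rfl
  omega

variable {T} in
lemma Desc.eq_of_depth_eq {u v w : V} (hv : T.Desc u v) (hw : T.Desc u w)
    (h : T.depth v = T.depth w) : v = w := by
  rw [← hv.2, ← hw.2, h]

lemma desc_iff {u v : V} : T.Desc u v ↔ u = v ∨ ∃ w, T.IsChild w v ∧ T.Desc u w := by
  constructor
  · rintro ⟨depth_le, hv⟩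
    rcases depth_le.eq_or_lt with depth_eq | depth_lt
    · left
      simpa [depth_eq] using hv
    · obtain ⟨k, hk⟩ := Nat.exists_eq_add_of_lt depth_lt
      have depth_child := T.depth_iterate_parent u (k := k) (by omega)
      refine .inr ⟨T.parent^[k] u, ⟨by omega, ?_⟩, by omega, ?_⟩
      · rwa [hk, show T.depth v + k + 1 - T.depth v = k + 1 by omega,
          Function.iterate_succ_apply'] at hv
      · rw [show T.depth u - T.depth (T.parent^[k] u) = k by omega]
  · rintro (rfl | ⟨w, ⟨depth_child, rfl⟩, depth_le, hw⟩)
    · exact T.desc_self u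
    · refine ⟨by omega, ?_⟩
      rw [show T.depth u - T.depth (T.parent w) = T.depth u - T.depth w + 1 by omega,
        Function.iterate_succ_apply', hw]

lemma wellFounded_isChild [Finite V] : WellFounded T.IsChild := by
  cases nonempty_fintype V
  refine Subrelation.wf (fun {w v} h ↦ ?_) (measure fun v ↦ Finset.univ.sup T.depth - T.depth v).wf
  have : T.depth w ≤ Finset.univ.sup T.depth := Finset.le_sup (Finset.mem_univ w)
  have := h.1
  change Finset.univ.sup T.depth - T.depth w < Finset.univ.sup T.depth - T.depth v
  omega

variable [Fintype V] [DecidableEq V]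

lemma filter_desc_eq (v : V) :
    ({u | T.Desc u v} : Finset V) = insert v (({w | T.IsChild w v} : Finset V).biUnion
      fun w ↦ {u | T.Desc u w}) := by
  ext u
  simp [T.desc_iff (v := v)]

/-- The sum of `f` over the descendants of `v`. -/
def subsum (f : V → ℝ) (v : V) : ℝ := ∑ u with T.Desc u v, f u

lemma subsum_eq (f : V → ℝ) (v : V) :
    T.subsum f v = f v + ∑ w with T.IsChild w v, T.subsum f w := by
  unfold subsum
  rw [filter_desc_eq, Finset.sum_insert, Finset.sum_biUnion]
  · simp only [Set.PairwiseDisjoint, Set.Pairwise, Finset.coe_filter, Finset.mem_univ, true_and,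
      Set.mem_ofPred_eq, Function.onFun, Finset.disjoint_left, Finset.mem_filter]
    intro w hw w' hw' ne u hu hu'
    exact ne (hu.eq_of_depth_eq hu' (hw.1.trans hw'.1.symm))
  · simp only [Finset.mem_biUnion, Finset.mem_filter, Finset.mem_univ, true_and, not_exists,
      not_and]
    intro w hw hv
    have := hw.1
    have := hv.1
    omega

lemma subsum_root (f : V → ℝ) : T.subsum f T.root = ∑ u, f u := by
  simp [subsum, T.desc_root]

lemma subsum_add (f g : V → ℝ) (v : V) :
    T.subsum (fun w ↦ f w + g w) v = T.subsum f v + T.subsum g v :=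
  Finset.sum_add_distrib

lemma subsum_sum_mul {ι : Type*} [Fintype ι] (z : ι → ℝ) (x : V → ι → ℝ) (v : V) :
    T.subsum (fun v ↦ ∑ j, z j * x v j) v = ∑ j, z j * T.subsum (fun v ↦ x v j) v := by
  simp only [subsum, Finset.mul_sum]
  exact Finset.sum_comm

lemma subsum_nonneg {f : V → ℝ} (hf : ∀ v, 0 ≤ f v) (v : V) : 0 ≤ T.subsum f v :=
  Finset.sum_nonneg fun u _ ↦ hf u

lemma subsum_le {f : V → ℝ} (hf : ∀ v, 0 ≤ f v) (v : V) : T.subsum f v ≤ ∑ u, f u :=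
  Finset.sum_le_sum_of_subset_of_nonneg (Finset.filter_subset _ _) fun u _ _ ↦ hf u

lemma card_ancestors_le (u : V) : Finset.card {v | T.Desc u v} ≤ T.depth u + 1 := by
  rw [← Finset.card_range (T.depth u + 1)]
  refine Finset.card_le_card_of_injOn T.depth (fun v hv ↦ ?_) fun v hv w hw h ↦ ?_
  · have := (Finset.mem_filter.1 hv).2.1
    simp only [Finset.coe_range, Set.mem_Iio]
    omega
  · exact (Finset.mem_filter.1 hv).2.eq_of_depth_eq (Finset.mem_filter.1 hw).2 h

section depth

variable {D : ℕ} {f : V → ℝ}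

lemma sum_subsum_le (hD : ∀ v, T.depth v ≤ D) (hf : ∀ v, 0 ≤ f v) :
    ∑ v, T.subsum f v ≤ (D + 1) * ∑ u, f u := by
  simp only [subsum, Finset.sum_filter]
  rw [Finset.sum_comm, Finset.mul_sum]
  refine Finset.sum_le_sum fun u _ ↦ ?_
  rw [← Finset.sum_filter, Finset.sum_const, nsmul_eq_mul]
  refine mul_le_mul_of_nonneg_right ?_ (hf u)
  exact_mod_cast (T.card_ancestors_le u).trans (Nat.succ_le_succ (hD u))

lemma sum_subsum_rpow_le (hD : ∀ v, T.depth v ≤ D) (hf : ∀ v, 0 ≤ f v) {p : ℝ} (hp : 1 ≤ p) :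
    ∑ v, T.subsum f v ^ p ≤ (D + 1) * (∑ u, f u) ^ p := by
  have rpow_eq {x : ℝ} (hx : 0 ≤ x) : x ^ p = x * x ^ (p - 1) := by
    rw [← Real.rpow_one_add' hx (by linarith), add_sub_cancel]
  have sum_nonneg : 0 ≤ ∑ u, f u := Finset.sum_nonneg fun u _ ↦ hf u
  calc _ ≤ ∑ v, T.subsum f v * (∑ u, f u) ^ (p - 1) := by
        refine Finset.sum_le_sum fun v _ ↦ ?_
        have := T.subsum_nonneg hf v
        rw [rpow_eq this]
        gcongr
        exact T.subsum_le hf v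
    _ ≤ ((D + 1) * ∑ u, f u) * (∑ u, f u) ^ (p - 1) := by
        rw [← Finset.sum_mul]
        gcongr
        exact T.sum_subsum_le hD hf
    _ = _ := by rw [rpow_eq sum_nonneg, mul_assoc]

end depth

/-! ### Aggregation along a tree -/

/-- The value at the vertex `v` when every vertex adds to its own number `x v` the values of its
children, each of which is transformed by `ρ w` on its way from `w` to the parent of `w`. -/
def agg (ρ : V → ℝ → ℝ) (x : V → ℝ) (v : V) : ℝ :=
  x v + ∑ w : {w // T.IsChild w v}, ρ w (agg ρ x w)
termination_by Finset.univ.sup T.depth - T.depth v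
decreasing_by
  have : T.depth w ≤ Finset.univ.sup T.depth := Finset.le_sup (Finset.mem_univ w.1)
  have := w.2.1
  omega

variable (ρ : V → ℝ → ℝ) (x : V → ℝ)

lemma agg_eq (v : V) : T.agg ρ x v = x v + ∑ w with T.IsChild w v, ρ w (T.agg ρ x w) := by
  rw [agg, ← Finset.sum_subtype_eq_sum_filter, Finset.subtype_univ]

lemma agg_add_eq_subsum (v : V) :
    T.agg ρ x v + (ρ v (T.agg ρ x v) - T.agg ρ x v)
      = T.subsum (fun w ↦ x w + (ρ w (T.agg ρ x w) - T.agg ρ x w)) v := by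
  induction v using T.wellFounded_isChild.induction with
  | h v ih =>
    have sum_children : ∑ w with T.IsChild w v,
        T.subsum (fun w ↦ x w + (ρ w (T.agg ρ x w) - T.agg ρ x w)) w
        = ∑ w with T.IsChild w v, ρ w (T.agg ρ x w) :=
      Finset.sum_congr rfl fun w hw ↦ by rw [← ih w (Finset.mem_filter.1 hw).2]; ring
    rw [T.subsum_eq, sum_children]
    linarith [T.agg_eq ρ x v]

lemma agg_eq_subsum (v : V) :
    T.agg ρ x v = T.subsum x v
      + ∑ w with T.Desc w v ∧ w ≠ v, (ρ w (T.agg ρ x w) - T.agg ρ x w) := by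
  set e : V → ℝ := fun w ↦ ρ w (T.agg ρ x w) - T.agg ρ x w
  have subsum_e : T.subsum e v = e v + ∑ w with T.Desc w v ∧ w ≠ v, e w := by
    rw [subsum, ← Finset.add_sum_erase _ _ (a := v) (by simp [T.desc_self]),
      Finset.filter_and_not, Finset.erase_eq, Finset.filter_eq']
    simp
  have agg_add : T.agg ρ x v + e v = T.subsum x v + T.subsum e v :=
    (T.agg_add_eq_subsum ρ x v).trans (T.subsum_add x e v)
  linarith

variable {ρ x}

lemma agg_congr {ρ' : V → ℝ → ℝ} (h : ∀ v, ρ' v (T.agg ρ x v) = ρ v (T.agg ρ x v)) (v : V) :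
    T.agg ρ' x v = T.agg ρ x v := by
  induction v using T.wellFounded_isChild.induction with
  | h v ih =>
    rw [T.agg_eq ρ', T.agg_eq ρ]
    congr 1
    exact Finset.sum_congr rfl fun w hw ↦ by rw [ih w (Finset.mem_filter.1 hw).2, h]

lemma agg_congr_of_depth {ρ' : V → ℝ → ℝ} {v : V} (h : ∀ w, T.depth v < T.depth w → ρ' w = ρ w) :
    T.agg ρ' x v = T.agg ρ x v := by
  induction v using T.wellFounded_isChild.induction with
  | h v ih =>
    rw [T.agg_eq ρ', T.agg_eq ρ]
    congr 1
    refine Finset.sum_congr rfl fun w hw ↦ ?_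
    have child := (Finset.mem_filter.1 hw).2
    have := child.1
    rw [ih w child fun w' hw' ↦ h w' (by omega), h w (by omega)]

end Rooting

/-! ### Second moments of the rounding errors -/

lemma preimage_update_univ_pi {ι : Type*} [DecidableEq ι] {X : ι → Type*} (i : ι)
    (s : ∀ j, Set (X j)) :
    (fun q : (∀ j, X j) × X i ↦ Function.update q.1 i q.2) ⁻¹' Set.univ.pi s
      = Set.univ.pi (Function.update s i Set.univ) ×ˢ s i := by
  ext q
  simp only [Set.mem_preimage, Set.mem_pi, Set.mem_univ, true_implies, Set.mem_prod]
  rw [Function.forall_update_iff q.1 (p := fun j y ↦ y ∈ s j),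
    Function.forall_update_iff s (p := fun j t ↦ q.1 j ∈ t), and_comm]
  simp

lemma measurePreserving_update {ι : Type*} [Fintype ι] [DecidableEq ι] {X : ι → Type*}
    [∀ i, MeasurableSpace (X i)] (μ : ∀ i, Measure (X i)) [∀ i, IsProbabilityMeasure (μ i)]
    (i : ι) :
    MeasurePreserving (fun q : (∀ j, X j) × X i ↦ Function.update q.1 i q.2)
      ((Measure.pi μ).prod (μ i)) (Measure.pi μ) := by
  refine ⟨measurable_update', (Measure.pi_eq fun s hs ↦ ?_).symm⟩
  rw [Measure.map_apply measurable_update' (MeasurableSet.univ_pi hs), preimage_update_univ_pi,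
    Measure.prod_prod, Measure.pi_pi, ← Finset.mul_prod_erase _ _ (Finset.mem_univ i),
    ← Finset.mul_prod_erase _ (fun j ↦ μ j (s j)) (Finset.mem_univ i), Function.update_self,
    measure_univ, one_mul, mul_comm]
  congr 1
  exact Finset.prod_congr rfl fun j hj ↦ by rw [Function.update_of_ne (Finset.ne_of_mem_erase hj)]

lemma integral_sq_add_sum_of_orthogonal {Ω ι : Type*} [MeasurableSpace Ω] {μ : Measure Ω}
    [IsProbabilityMeasure μ] (a : ℝ) {e : ι → Ω → ℝ} (memLp : ∀ i, MemLp (e i) 2 μ)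
    (centered : ∀ i, ∫ ω, e i ω ∂μ = 0) (orthogonal : ∀ i j, i ≠ j → ∫ ω, e i ω * e j ω ∂μ = 0)
    (S : Finset ι) :
    ∫ ω, (a + ∑ i ∈ S, e i ω) ^ 2 ∂μ = a ^ 2 + ∑ i ∈ S, ∫ ω, e i ω ^ 2 ∂μ := by
  classical
  induction S using Finset.induction_on with
  | empty => simp
  | insert i S hi ih =>
    have memLp_partial : MemLp (fun ω ↦ a + ∑ j ∈ S, e j ω) 2 μ :=
      (memLp_const a).add (memLp_finsetSum S fun j _ ↦ memLp j)
    have int_mul (j : ι) : Integrable (fun ω ↦ e i ω * e j ω) μ :=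
      (memLp i).integrable_mul (memLp j)
    have cross_term : ∫ ω, e i ω * (a + ∑ j ∈ S, e j ω) ∂μ = 0 := by
      simp_rw [mul_add, Finset.mul_sum]
      rw [integral_add (((memLp i).integrable (by norm_num)).mul_const a)
        (integrable_finsetSum _ fun j _ ↦ int_mul j), integral_mul_const, centered,
        integral_finsetSum _ fun j _ ↦ int_mul j, Finset.sum_eq_zero, zero_mul, zero_add]
      exact fun j hj ↦ orthogonal i j fun h ↦ hi (h ▸ hj)
    have int_cross : Integrable (fun ω ↦ 2 * (e i ω * (a + ∑ j ∈ S, e j ω))) μ :=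
      ((memLp i).integrable_mul memLp_partial).const_mul 2
    have int_first : Integrable (fun ω ↦ e i ω ^ 2 + 2 * (e i ω * (a + ∑ j ∈ S, e j ω))) μ :=
      (memLp i).integrable_sq.add int_cross
    calc _ = ∫ ω, (e i ω ^ 2 + 2 * (e i ω * (a + ∑ j ∈ S, e j ω))
            + (a + ∑ j ∈ S, e j ω) ^ 2) ∂μ := by
          congr with ω
          rw [Finset.sum_insert hi]
          ring
      _ = ∫ ω, e i ω ^ 2 ∂μ + 0 + (a ^ 2 + ∑ i ∈ S, ∫ ω, e i ω ^ 2 ∂μ) := by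
          rw [integral_add int_first memLp_partial.integrable_sq,
            integral_add (memLp i).integrable_sq int_cross, ih, integral_const_mul, cross_term,
            mul_zero]
      _ = _ := by rw [Finset.sum_insert hi]; ring

lemma measurable_fround_comp {α : Type*} [MeasurableSpace α] (A b : ℕ) {f g : α → ℝ}
    (hf : Measurable f) (hg : Measurable g) : Measurable fun a ↦ fround A b (f a) (g a) := by
  simpa only [Function.comp_def] using (measurable_fround A b).comp (hf.prodMk hg)

lemma abs_fround_sub_le_abs_add_one (A b : ℕ) (y u : ℝ) : |fround A b y u - y| ≤ |y| + 1 := by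
  refine abs_le_of_sq_le_sq (sq_fround_sub_le.trans ?_) (by positivity)
  calc _ ≤ 1 * (y ^ 2 + 1) := by
        gcongr <;> exact pow_le_one₀ (by norm_num) (by norm_num)
    _ ≤ _ := by rw [← sq_abs y]; nlinarith [abs_nonneg y]

namespace Rooting

variable {V : Type*} [Fintype V] [DecidableEq V] (T : Rooting V) (A b : ℕ)

/-- The value at `v` when the numbers `x` are aggregated with floating point rounding, the rounding
at the vertex `w` using the shift `u w`. -/
noncomputable def noisy (x u : V → ℝ) (v : V) : ℝ :=
  T.agg (fun w y ↦ fround A b y (u w)) x v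

/-- The rounding error made at the vertex `v`. -/
noncomputable def err (x u : V → ℝ) (v : V) : ℝ :=
  fround A b (T.noisy A b x u v) (u v) - T.noisy A b x u v

lemma noisy_eq (x u : V → ℝ) (v : V) :
    T.noisy A b x u v = x v + ∑ w with T.IsChild w v, fround A b (T.noisy A b x u w) (u w) :=
  T.agg_eq _ x v

lemma noisy_eq_subsum_add (x u : V → ℝ) (v : V) :
    T.noisy A b x u v = T.subsum x v + ∑ w with T.Desc w v ∧ w ≠ v, T.err A b x u w :=
  T.agg_eq_subsum _ x v

lemma measurable_noisy (v : V) :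
    Measurable fun q : (V → ℝ) × (V → ℝ) ↦ T.noisy A b q.1 q.2 v := by
  induction v using T.wellFounded_isChild.induction with
  | h v ih =>
    simp_rw [T.noisy_eq A b _ _ v]
    have meas_input : Measurable fun q : (V → ℝ) × (V → ℝ) ↦ q.1 v := by fun_prop
    refine meas_input.add (Finset.measurable_sum _ fun w hw ↦ ?_)
    exact measurable_fround_comp A b (ih w (Finset.mem_filter.1 hw).2) (by fun_prop)

lemma measurable_err (v : V) : Measurable fun q : (V → ℝ) × (V → ℝ) ↦ T.err A b q.1 q.2 v :=
  (measurable_fround_comp A b (T.measurable_noisy A b v) (by fun_prop)).sub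
    (T.measurable_noisy A b v)

variable (x : V → ℝ)

lemma exists_abs_noisy_le (v : V) : ∃ C, ∀ u, |T.noisy A b x u v| ≤ C := by
  induction v using T.wellFounded_isChild.induction with
  | h v ih =>
    choose! C hC using ih
    refine ⟨|x v| + ∑ w with T.IsChild w v, (2 * C w + 1), fun u ↦ ?_⟩
    rw [noisy_eq]
    refine (abs_add_le _ _).trans (add_le_add_right ?_ _)
    refine (Finset.abs_sum_le_sum_abs _ _).trans (Finset.sum_le_sum fun w hw ↦ ?_)
    linarith [hC w (Finset.mem_filter.1 hw).2 u,
      abs_fround_sub_le_abs_add_one A b (T.noisy A b x u w) (u w),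
      abs_sub_abs_le_abs_sub (fround A b (T.noisy A b x u w) (u w)) (T.noisy A b x u w)]

/-- The law of the independent uniform shifts used for rounding. -/
noncomputable abbrev shiftLaw (V : Type*) [Fintype V] : Measure (V → ℝ) := Measure.pi fun _ ↦ unif

lemma memLp_noisy (v : V) : MemLp (fun u ↦ T.noisy A b x u v) 2 (shiftLaw V) := by
  obtain ⟨C, hC⟩ := T.exists_abs_noisy_le A b x v
  exact MemLp.of_bound ((T.measurable_noisy A b v).comp
    (measurable_const.prodMk measurable_id)).aestronglyMeasurable C (ae_of_all _ hC)

lemma memLp_err (v : V) : MemLp (fun u ↦ T.err A b x u v) 2 (shiftLaw V) := by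
  obtain ⟨C, hC⟩ := T.exists_abs_noisy_le A b x v
  refine MemLp.of_bound ((T.measurable_err A b v).comp
    (measurable_const.prodMk measurable_id)).aestronglyMeasurable (C + 1) (ae_of_all _ fun u ↦ ?_)
  exact (abs_fround_sub_le_abs_add_one A b _ _).trans (add_le_add_left (hC u) 1)

lemma noisy_update (u : V → ℝ) {v w : V} (h : T.depth w ≤ T.depth v) (s : ℝ) :
    T.noisy A b x (Function.update u w s) v = T.noisy A b x u v := by
  refine T.agg_congr_of_depth fun w' hw' ↦ ?_
  have : w' ≠ w := by rintro rfl; omega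
  simp only [Function.update_of_ne this]

-- The error at `v` is centred given all other shifts, because `noisy v` does not depend on `u v`.
lemma integral_mul_err (v : V) {g : (V → ℝ) → ℝ}
    (hg : Integrable (fun u ↦ g u * T.err A b x u v) (shiftLaw V))
    (h : ∀ u s, g (Function.update u v s) = g u) :
    ∫ u, g u * T.err A b x u v ∂(shiftLaw V) = 0 := by
  have resample := measurePreserving_update (fun _ : V ↦ unif) v
  have integral_eq : ∫ u, g u * T.err A b x u v ∂(shiftLaw V)
      = ∫ q : (V → ℝ) × ℝ, g (Function.update q.1 v q.2) *
        T.err A b x (Function.update q.1 v q.2) v ∂((shiftLaw V).prod unif) := by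
    have := integral_map (μ := (shiftLaw V).prod unif) resample.measurable.aemeasurable
      (f := fun u ↦ g u * T.err A b x u v)
      (by rw [resample.map_eq]; exact hg.aestronglyMeasurable)
    rwa [resample.map_eq] at this
  have integrable : Integrable (fun q : (V → ℝ) × ℝ ↦ g (Function.update q.1 v q.2) *
      T.err A b x (Function.update q.1 v q.2) v) ((shiftLaw V).prod unif) :=
    resample.integrable_comp_of_integrable hg
  rw [integral_eq, integral_prod _ integrable]
  refine integral_eq_zero_of_ae (ae_of_all _ fun u ↦ ?_)
  simp only [h, err, T.noisy_update A b x u le_rfl, Function.update_self, Pi.zero_apply]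
  rw [integral_const_mul, integral_fround_sub, mul_zero]

lemma integral_err (v : V) : ∫ u, T.err A b x u v ∂(shiftLaw V) = 0 := by
  have := T.integral_mul_err A b x v (g := fun _ ↦ 1)
    (by simpa using (T.memLp_err A b x v).integrable (by norm_num)) (by simp)
  simpa using this

lemma integral_err_mul_err {v w : V} (hvw : v ≠ w) :
    ∫ u, T.err A b x u v * T.err A b x u w ∂(shiftLaw V) = 0 := by
  wlog h : T.depth w ≤ T.depth v generalizing v w
  · simp_rw [mul_comm (T.err A b x _ v)]
    exact this hvw.symm (by omega)
  refine T.integral_mul_err A b x w (g := fun u ↦ T.err A b x u v)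
    ((T.memLp_err A b x v).integrable_mul (T.memLp_err A b x w)) fun u s ↦ ?_
  simp only [err, T.noisy_update A b x u h, Function.update_of_ne hvw]

lemma integral_sq_add_sum_err (a : ℝ) (S : Finset V) :
    ∫ u, (a + ∑ w ∈ S, T.err A b x u w) ^ 2 ∂(shiftLaw V)
      = a ^ 2 + ∑ w ∈ S, ∫ u, T.err A b x u w ^ 2 ∂(shiftLaw V) :=
  integral_sq_add_sum_of_orthogonal a (T.memLp_err A b x) (T.integral_err A b x)
    (fun _ _ h ↦ T.integral_err_mul_err A b x h) S

lemma integral_err_sq_le (v : V) :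
    ∫ u, T.err A b x u v ^ 2 ∂(shiftLaw V)
      ≤ (1 / 4) ^ b * (∫ u, T.noisy A b x u v ^ 2 ∂(shiftLaw V) + (1 / 4) ^ A) := by
  have integrable_sq := (T.memLp_noisy A b x v).integrable_sq
  calc _ ≤ ∫ u, (1 / 4) ^ b * (T.noisy A b x u v ^ 2 + (1 / 4) ^ A) ∂(shiftLaw V) :=
        integral_mono (T.memLp_err A b x v).integrable_sq
          ((integrable_sq.add (integrable_const _)).const_mul _) fun u ↦ sq_fround_sub_le
    _ = _ := by
        rw [integral_const_mul, integral_add integrable_sq (integrable_const _)]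
        simp

lemma integral_noisy_sq_add_nonneg (v : V) :
    0 ≤ ∫ u, T.noisy A b x u v ^ 2 ∂(shiftLaw V) + (1 / 4) ^ A :=
  add_nonneg (integral_nonneg fun u ↦ sq_nonneg _) (by positivity)

lemma integral_noisy_sq_add_le (v : V) :
    ∫ u, T.noisy A b x u v ^ 2 ∂(shiftLaw V) + (1 / 4) ^ A
      ≤ (T.subsum x v ^ 2 + (1 / 4) ^ A) + (1 / 4) ^ b *
        T.subsum (fun w ↦ ∫ u, T.noisy A b x u w ^ 2 ∂(shiftLaw V) + (1 / 4) ^ A) v := by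
  have sum_err_le : ∑ w with T.Desc w v ∧ w ≠ v, ∫ u, T.err A b x u w ^ 2 ∂(shiftLaw V)
      ≤ (1 / 4) ^ b *
        T.subsum (fun w ↦ ∫ u, T.noisy A b x u w ^ 2 ∂(shiftLaw V) + (1 / 4) ^ A) v := by
    rw [subsum, Finset.mul_sum]
    refine (Finset.sum_le_sum fun w _ ↦ T.integral_err_sq_le A b x w).trans ?_
    exact Finset.sum_le_sum_of_subset_of_nonneg
      (Finset.monotone_filter_right _ fun w _ hw ↦ hw.1)
      fun w _ _ ↦ mul_nonneg (by positivity) (T.integral_noisy_sq_add_nonneg A b x w)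
  have integral_noisy_sq := T.integral_sq_add_sum_err A b x (T.subsum x v) {w | T.Desc w v ∧ w ≠ v}
  simp_rw [← noisy_eq_subsum_add] at integral_noisy_sq
  rw [integral_noisy_sq]
  linarith

section depth

variable {A b} {D : ℕ} (hD : ∀ v, T.depth v ≤ D) (hb : (1 / 4 : ℝ) ^ b * (D + 1) ≤ 1 / 2)

include hD hb

-- Each vertex has at most `D + 1` ancestors, so by `hb` at most half of the left-hand side
-- reappears when `integral_noisy_sq_add_le` is summed.
lemma sum_integral_noisy_sq_add_le :
    ∑ v, (∫ u, T.noisy A b x u v ^ 2 ∂(shiftLaw V) + (1 / 4) ^ A)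
      ≤ 2 * ∑ v, (T.subsum x v ^ 2 + (1 / 4) ^ A) := by
  set c : V → ℝ := fun v ↦ ∫ u, T.noisy A b x u v ^ 2 ∂(shiftLaw V) + (1 / 4) ^ A
  have c_nonneg : ∀ v, 0 ≤ c v := T.integral_noisy_sq_add_nonneg A b x
  have recursion : ∑ v, c v
      ≤ ∑ v, (T.subsum x v ^ 2 + (1 / 4) ^ A) + (1 / 4) ^ b * ∑ v, T.subsum c v := by
    rw [Finset.mul_sum, ← Finset.sum_add_distrib]
    exact Finset.sum_le_sum fun v _ ↦ T.integral_noisy_sq_add_le A b x v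
  have absorbed : (1 / 4 : ℝ) ^ b * ∑ v, T.subsum c v ≤ 1 / 2 * ∑ v, c v := by
    have sum_nonneg : 0 ≤ ∑ v, c v := Finset.sum_nonneg fun v _ ↦ c_nonneg v
    calc _ ≤ (1 / 4 : ℝ) ^ b * ((D + 1) * ∑ v, c v) := by
          gcongr
          exact T.sum_subsum_le hD c_nonneg
      _ = ((1 / 4 : ℝ) ^ b * (D + 1)) * ∑ v, c v := by ring
      _ ≤ _ := by gcongr
  linarith

lemma integral_noisy_sq_le (v : V) :
    ∫ u, T.noisy A b x u v ^ 2 ∂(shiftLaw V) ≤ 2 * ∑ v, (T.subsum x v ^ 2 + (1 / 4) ^ A) := by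
  refine le_trans ?_ (T.sum_integral_noisy_sq_add_le x hD hb)
  refine (le_add_of_nonneg_right (by positivity : (0 : ℝ) ≤ (1 / 4) ^ A)).trans ?_
  exact Finset.single_le_sum
    (f := fun v ↦ ∫ u, T.noisy A b x u v ^ 2 ∂(shiftLaw V) + (1 / 4) ^ A)
    (fun v _ ↦ T.integral_noisy_sq_add_nonneg A b x v) (Finset.mem_univ v)

theorem integral_noisy_root_sub_sq_le :
    ∫ u, (T.noisy A b x u T.root - ∑ v, x v) ^ 2 ∂(shiftLaw V)
      ≤ (1 / 4) ^ b * (2 * ∑ v, (T.subsum x v ^ 2 + (1 / 4) ^ A)) := by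
  have integral_eq := T.integral_sq_add_sum_err A b x 0 {w | T.Desc w T.root ∧ w ≠ T.root}
  simp_rw [zero_add, zero_pow two_ne_zero, zero_add] at integral_eq
  simp_rw [noisy_eq_subsum_add, T.subsum_root, add_sub_cancel_left]
  rw [integral_eq]
  refine (Finset.sum_le_sum fun w _ ↦ T.integral_err_sq_le A b x w).trans ?_
  rw [← Finset.mul_sum]
  gcongr
  exact le_trans (Finset.sum_le_sum_of_subset_of_nonneg (Finset.subset_univ _)
    fun w _ _ ↦ T.integral_noisy_sq_add_nonneg A b x w) (T.sum_integral_noisy_sq_add_le x hD hb)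

end depth

end Rooting

/-! ### Moments of one entry of the sketch -/

lemma lintegral_abs_rpow_le_of_memLp_two {Ω : Type*} [MeasurableSpace Ω] {μ : Measure Ω}
    [IsProbabilityMeasure μ] {f : Ω → ℝ} (hf : MemLp f 2 μ) {q : ℝ} (hq : 0 < q) (hq2 : q ≤ 2) :
    ∫⁻ ω, ENNReal.ofReal (|f ω| ^ q) ∂μ ≤ ENNReal.ofReal ((∫ ω, f ω ^ 2 ∂μ) ^ (q / 2)) := by
  have integrable : Integrable (fun ω ↦ |f ω| ^ q) μ := by
    have memLp : MemLp f (ENNReal.ofReal q) μ :=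
      hf.mono_exponent (by simpa using ENNReal.ofReal_le_ofReal hq2)
    simpa [hq.le] using memLp.integrable_norm_rpow'
  rw [← ofReal_integral_eq_lintegral_ofReal integrable
    (ae_of_all _ fun ω ↦ Real.rpow_nonneg (abs_nonneg _) _)]
  refine ENNReal.ofReal_le_ofReal ?_
  simp_rw [abs_rpow_eq_sq_rpow_half] at integrable ⊢
  exact (Real.concaveOn_rpow (half_pos hq).le (by linarith)).le_map_integral
    (Real.continuous_rpow_const (half_pos hq).le).continuousOn isClosed_Ici
    (ae_of_all _ fun ω ↦ sq_nonneg (f ω)) hf.integrable_sq integrable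

lemma IsStable.lintegral_rpow_sum_sq_add_le {p : ℝ} {ν : Measure ℝ} [IsProbabilityMeasure ν]
    (h : IsStable p ν) (hp : 1 ≤ p) (hp2 : p ≤ 2) {m : ℕ} {ι : Type*} [Fintype ι]
    (x : Fin m → ι → ℝ) {δ : ℝ} (hδ : 0 ≤ δ) (hmδ : m * δ ≤ 1) :
    ∫⁻ z, ENNReal.ofReal ((∑ v, ((∑ j, z j * x v j) ^ 2 + δ)) ^ (1 / 8 : ℝ))
        ∂(Measure.pi fun _ : ι ↦ ν)
      ≤ ENNReal.ofReal (4 * quarterMoment ν * (∑ v, ∑ j, |x v j| ^ p) ^ (1 / 4 / p) + 1) := by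
  have := h.le_quarterMoment hp
  have split_floor (z : ι → ℝ) : (∑ v, ((∑ j, z j * x v j) ^ 2 + δ)) ^ (1 / 8 : ℝ)
      ≤ (∑ v, (∑ j, z j * x v j) ^ 2) ^ (1 / 8 : ℝ) + 1 := by
    rw [Finset.sum_add_distrib]
    refine (Real.rpow_add_le_add_rpow (by positivity) (by positivity) (by norm_num)
      (by norm_num)).trans ?_
    gcongr
    exact Real.rpow_le_one (by positivity) (by simpa using hmδ) (by norm_num)
  calc _ ≤ ∫⁻ z, (ENNReal.ofReal ((∑ v, (∑ j, z j * x v j) ^ 2) ^ (1 / 8 : ℝ))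
          + ENNReal.ofReal 1) ∂(Measure.pi fun _ : ι ↦ ν) := by
        refine lintegral_mono fun z ↦ ?_
        rw [← ENNReal.ofReal_add (by positivity) zero_le_one]
        exact ENNReal.ofReal_le_ofReal (split_floor z)
    _ ≤ ENNReal.ofReal (4 * quarterMoment ν * (∑ v, ∑ j, |x v j| ^ p) ^ (1 / 4 / p))
          + ENNReal.ofReal 1 := by
        rw [lintegral_add_right _ measurable_const, lintegral_const, measure_univ, mul_one]
        gcongr
        exact h.lintegral_sum_sq_le hp hp2 x
    _ = _ := (ENNReal.ofReal_add (by positivity) zero_le_one).symm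

lemma Fp_nonneg {m n : ℕ} (p : ℝ) (X : Fin m → Fin n → ℕ) : 0 ≤ Fp p X :=
  Finset.sum_nonneg fun _ _ ↦ Real.rpow_nonneg (abs_nonneg _) _

namespace Rooting

variable {m n : ℕ} (T : Rooting (Fin m)) (A b : ℕ)

/-- The law of the randomness behind one entry of the sketch: the coefficients of the linear form,
and the shifts used for rounding. -/
noncomputable abbrev entryLaw (m n : ℕ) (ν : Measure ℝ) : Measure ((Fin n → ℝ) × (Fin m → ℝ)) :=
  (Measure.pi fun _ ↦ ν).prod (shiftLaw (Fin m))

/-- The value of one entry of the sketch at the vertex `v`, before `v` rounds it: the players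
aggregate the linear form `∑ j, ω.1 j * X v j` towards the root. -/
noncomputable def entry (X : Fin m → Fin n → ℕ) (ω : (Fin n → ℝ) × (Fin m → ℝ)) (v : Fin m) : ℝ :=
  T.noisy A b (fun v ↦ ∑ j, ω.1 j * X v j) ω.2 v

lemma measurable_entry (X : Fin m → Fin n → ℕ) (v : Fin m) :
    Measurable fun ω ↦ T.entry A b X ω v := by
  have inputs : Measurable fun ω : (Fin n → ℝ) × (Fin m → ℝ) ↦
      ((fun v ↦ ∑ j, ω.1 j * (X v j : ℝ) : Fin m → ℝ), ω.2) :=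
    (measurable_pi_lambda _ fun v ↦ (measurable_sum_mul fun j ↦ (X v j : ℝ)).comp
      measurable_fst).prodMk measurable_snd
  simpa only [Function.comp_def, entry] using (T.measurable_noisy A b v).comp inputs

lemma sum_subsum_rpow_le_Fp {p : ℝ} (hp : 1 ≤ p) {D : ℕ} (hD : ∀ v, T.depth v ≤ D)
    (X : Fin m → Fin n → ℕ) :
    ∑ v, ∑ j, |T.subsum (fun v ↦ (X v j : ℝ)) v| ^ p ≤ (D + 1) * Fp p X := by
  rw [Finset.sum_comm, Fp, Finset.mul_sum]
  refine Finset.sum_le_sum fun j _ ↦ ?_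
  have input_nonneg (v : Fin m) : 0 ≤ (X v j : ℝ) := Nat.cast_nonneg _
  rw [abs_of_nonneg (Finset.sum_nonneg fun i _ ↦ input_nonneg i)]
  simp_rw [abs_of_nonneg (T.subsum_nonneg input_nonneg _)]
  exact T.sum_subsum_rpow_le hD input_nonneg hp

lemma rpow_sum_subsum_rpow_le {p : ℝ} (hp : 1 ≤ p) {D : ℕ} (hD : ∀ v, T.depth v ≤ D)
    (X : Fin m → Fin n → ℕ) {s : ℝ} (hs : 0 ≤ s) (hs1 : s ≤ 1) :
    (∑ v, ∑ j, |T.subsum (fun v ↦ (X v j : ℝ)) v| ^ p) ^ s ≤ (D + 1) * Fp p X ^ s := by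
  have sum_nonneg : 0 ≤ ∑ v, ∑ j, |T.subsum (fun v ↦ (X v j : ℝ)) v| ^ p :=
    Finset.sum_nonneg fun v _ ↦ Finset.sum_nonneg fun j _ ↦ Real.rpow_nonneg (abs_nonneg _) _
  calc _ ≤ ((D + 1) * Fp p X) ^ s :=
        Real.rpow_le_rpow sum_nonneg (T.sum_subsum_rpow_le_Fp hp hD X) hs
    _ = (D + 1 : ℝ) ^ s * Fp p X ^ s := Real.mul_rpow (by positivity) (Fp_nonneg p X)
    _ ≤ (D + 1) * Fp p X ^ s := by
        refine mul_le_mul_of_nonneg_right ?_ (Real.rpow_nonneg (Fp_nonneg p X) s)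
        exact Real.rpow_le_self_of_one_le (by linarith [(Nat.cast_nonneg D : (0 : ℝ) ≤ D)]) hs1

section Moments

variable {p : ℝ} {ν : Measure ℝ} [IsProbabilityMeasure ν] {A b} {D : ℕ} (hν : IsStable p ν)
  (hp : 1 ≤ p) (hp2 : p ≤ 2) (hD : ∀ v, T.depth v ≤ D) (hA : m * (1 / 4 : ℝ) ^ A ≤ 1)
  (X : Fin m → Fin n → ℕ) (hF : 1 ≤ Fp p X)

include hν hp hp2 hD hA hF

lemma lintegral_rpow_sum_subsum_sq_le :
    ∫⁻ z, ENNReal.ofReal ((∑ v, (T.subsum (fun v ↦ ∑ j, z j * (X v j : ℝ)) v ^ 2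
        + (1 / 4) ^ A)) ^ (1 / 8 : ℝ)) ∂(Measure.pi fun _ : Fin n ↦ ν)
      ≤ ENNReal.ofReal (8 * quarterMoment ν * (D + 1) * Fp p X ^ (1 / 4 / p)) := by
  have := hν.le_quarterMoment hp
  have norm_le := T.rpow_sum_subsum_rpow_le hp hD X (s := 1 / 4 / p) (by positivity)
    (by rw [div_le_one (by linarith)]; linarith)
  have one_le : 1 ≤ (D + 1) * Fp p X ^ (1 / 4 / p) :=
    one_le_mul_of_one_le_of_one_le (by linarith [(Nat.cast_nonneg D : (0 : ℝ) ≤ D)])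
      (Real.one_le_rpow hF (by positivity))
  simp_rw [T.subsum_sum_mul]
  refine (hν.lintegral_rpow_sum_sq_add_le hp hp2 _ (by positivity) hA).trans
    (ENNReal.ofReal_le_ofReal ?_)
  calc _ ≤ 4 * quarterMoment ν * ((D + 1) * Fp p X ^ (1 / 4 / p)) + 1 := by
        exact add_le_add_left (mul_le_mul_of_nonneg_left norm_le (by positivity)) 1
    _ ≤ _ := by nlinarith

lemma lintegral_rpow_quarter_le_of_integral_sq_le {f : (Fin n → ℝ) → (Fin m → ℝ) → ℝ}
    (hfm : Measurable fun ω : (Fin n → ℝ) × (Fin m → ℝ) ↦ f ω.1 ω.2)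
    (hf : ∀ z, MemLp (f z) 2 (shiftLaw (Fin m))) {c : ℝ} (hc : 0 ≤ c)
    (h : ∀ z, ∫ u, f z u ^ 2 ∂(shiftLaw (Fin m)) ≤
      c * (2 * ∑ v, (T.subsum (fun v ↦ ∑ j, z j * (X v j : ℝ)) v ^ 2 + (1 / 4) ^ A))) :
    ∫⁻ ω, ENNReal.ofReal (|f ω.1 ω.2| ^ (1 / 4 : ℝ)) ∂(entryLaw m n ν)
      ≤ ENNReal.ofReal (16 * c ^ (1 / 8 : ℝ) * quarterMoment ν * (D + 1)
        * Fp p X ^ (1 / 4 / p)) := by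
  have := hν.le_quarterMoment hp
  set Q : (Fin n → ℝ) → ℝ := fun z ↦
    ∑ v, (T.subsum (fun v ↦ ∑ j, z j * (X v j : ℝ)) v ^ 2 + (1 / 4) ^ A)
  have given_form (z : Fin n → ℝ) :
      ∫⁻ u, ENNReal.ofReal (|f z u| ^ (1 / 4 : ℝ)) ∂(shiftLaw (Fin m))
        ≤ ENNReal.ofReal (2 * c ^ (1 / 8 : ℝ)) * ENNReal.ofReal (Q z ^ (1 / 8 : ℝ)) := by
    have Q_nonneg : 0 ≤ Q z := Finset.sum_nonneg fun v _ ↦ by positivity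
    refine (lintegral_abs_rpow_le_of_memLp_two (hf z) (by norm_num) (by norm_num)).trans ?_
    rw [← ENNReal.ofReal_mul (by positivity)]
    refine ENNReal.ofReal_le_ofReal ?_
    calc _ ≤ (c * (2 * Q z)) ^ (1 / 4 / 2 : ℝ) := by gcongr; exact h z
      _ = 2 ^ (1 / 8 : ℝ) * (c ^ (1 / 8 : ℝ) * Q z ^ (1 / 8 : ℝ)) := by
          rw [Real.mul_rpow hc (by positivity), Real.mul_rpow zero_le_two Q_nonneg]
          norm_num
          ring
      _ ≤ 2 * (c ^ (1 / 8 : ℝ) * Q z ^ (1 / 8 : ℝ)) := by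
          gcongr
          exact Real.rpow_le_self_of_one_le one_le_two (by norm_num)
      _ = _ := by ring
  have measurable : Measurable fun ω : (Fin n → ℝ) × (Fin m → ℝ) ↦
      ENNReal.ofReal (|f ω.1 ω.2| ^ (1 / 4 : ℝ)) :=
    ((measurable_abs_rpow (1 / 4)).comp hfm).ennreal_ofReal
  rw [lintegral_prod _ measurable.aemeasurable]
  refine (lintegral_mono given_form).trans ?_
  rw [lintegral_const_mul' _ _ ENNReal.ofReal_ne_top]
  calc _ ≤ ENNReal.ofReal (2 * c ^ (1 / 8 : ℝ)) *
          ENNReal.ofReal (8 * quarterMoment ν * (D + 1) * Fp p X ^ (1 / 4 / p)) := by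
        gcongr
        exact T.lintegral_rpow_sum_subsum_sq_le hν hp hp2 hD hA X hF
    _ = _ := by
        rw [← ENNReal.ofReal_mul (by positivity)]
        ring_nf

lemma lintegral_entry_le (hb : (1 / 4 : ℝ) ^ b * (D + 1) ≤ 1 / 2) (v : Fin m) :
    ∫⁻ ω, ENNReal.ofReal (|T.entry A b X ω v| ^ (1 / 4 : ℝ)) ∂(entryLaw m n ν)
      ≤ ENNReal.ofReal (16 * quarterMoment ν * (D + 1) * Fp p X ^ (1 / 4 / p)) := by
  have := T.lintegral_rpow_quarter_le_of_integral_sq_le hν hp hp2 hD hA X hF (c := 1)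
    (f := fun z u ↦ T.entry A b X (z, u) v) (T.measurable_entry A b X v)
    (fun z ↦ T.memLp_noisy A b (fun v ↦ ∑ j, z j * (X v j : ℝ)) v) zero_le_one
    (fun z ↦ by
      rw [one_mul]
      exact T.integral_noisy_sq_le (fun v ↦ ∑ j, z j * (X v j : ℝ)) hD hb v)
  simpa only [Real.one_rpow, mul_one] using this

lemma lintegral_entry_root_sub_le (hb : (1 / 4 : ℝ) ^ b * (D + 1) ≤ 1 / 2) :
    ∫⁻ ω, ENNReal.ofReal (|T.entry A b X ω T.root - ∑ j, ω.1 j * ∑ v, (X v j : ℝ)|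
        ^ (1 / 4 : ℝ)) ∂(entryLaw m n ν)
      ≤ ENNReal.ofReal (16 * ((1 / 4 : ℝ) ^ b) ^ (1 / 8 : ℝ) * quarterMoment ν * (D + 1)
        * Fp p X ^ (1 / 4 / p)) := by
  have form_eq_sum (z : Fin n → ℝ) :
      ∑ j, z j * ∑ v, (X v j : ℝ) = ∑ v, ∑ j, z j * (X v j : ℝ) := by
    simp_rw [Finset.mul_sum]
    exact Finset.sum_comm
  have measurable_form : Measurable fun ω : (Fin n → ℝ) × (Fin m → ℝ) ↦
      ∑ j, ω.1 j * ∑ v, (X v j : ℝ) :=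
    (measurable_sum_mul fun j ↦ ∑ v, (X v j : ℝ)).comp measurable_fst
  refine T.lintegral_rpow_quarter_le_of_integral_sq_le hν hp hp2 hD hA X hF (c := (1 / 4) ^ b)
    (f := fun z u ↦ T.entry A b X (z, u) T.root - ∑ j, z j * ∑ v, (X v j : ℝ))
    ((T.measurable_entry A b X T.root).sub measurable_form)
    (fun z ↦ (T.memLp_noisy A b (fun v ↦ ∑ j, z j * (X v j : ℝ)) T.root).sub
      (memLp_const (∑ j, z j * ∑ v, (X v j : ℝ)))) (by positivity) fun z ↦ ?_
  simp_rw [form_eq_sum]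
  exact T.integral_noisy_root_sub_sq_le (fun v ↦ ∑ j, z j * (X v j : ℝ)) hD hb

end Moments

end Rooting

/-! ### Concentration of the sketch -/

lemma one_le_Fp {m n : ℕ} {p : ℝ} (hp : 0 ≤ p) {X : Fin m → Fin n → ℕ} {i : Fin m} {j : Fin n}
    (h : X i j ≠ 0) : 1 ≤ Fp p X := by
  have one_le_sum : (1 : ℝ) ≤ ∑ i, (X i j : ℝ) := by
    refine le_trans ?_ (Finset.single_le_sum (f := fun i ↦ (X i j : ℝ))
      (fun _ _ ↦ Nat.cast_nonneg _) (Finset.mem_univ i))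
    exact_mod_cast Nat.one_le_iff_ne_zero.2 h
  refine (Real.one_le_rpow (one_le_sum.trans (le_abs_self _)) hp).trans
    (Finset.single_le_sum (f := fun j ↦ |∑ i, (X i j : ℝ)| ^ p)
      (fun _ _ ↦ Real.rpow_nonneg (abs_nonneg _) _) (Finset.mem_univ j))

lemma abs_abs_rpow_sub_le {q : ℝ} (hq : 0 ≤ q) (hq1 : q ≤ 1) (x y : ℝ) :
    |(|x| ^ q - |y| ^ q)| ≤ |x - y| ^ q := by
  have triangle (x y : ℝ) : |x| ^ q ≤ |y| ^ q + |x - y| ^ q := by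
    refine le_trans ?_ (Real.rpow_add_le_add_rpow (abs_nonneg y) (abs_nonneg _) hq hq1)
    gcongr
    simpa using abs_add_le y (x - y)
  have lower := triangle y x
  rw [abs_sub_comm y x] at lower
  exact abs_le.2 ⟨by linarith, by linarith [triangle x y]⟩

section Independent

variable {Ω : Type*} [MeasurableSpace Ω] {μ : Measure Ω} [IsProbabilityMeasure μ]
  {ι : Type*} [Fintype ι] {f : Ω → ℝ} {t : ℝ}

lemma lintegral_pi_sum_eval (hf : Measurable f) (hf0 : ∀ ω, 0 ≤ f ω) :
    ∫⁻ ω, ENNReal.ofReal (∑ i, f (ω i)) ∂(Measure.pi fun _ : ι ↦ μ)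
      = Fintype.card ι * ∫⁻ ω, ENNReal.ofReal (f ω) ∂μ := by
  calc _ = ∑ i, ∫⁻ ω, ENNReal.ofReal (f (ω i)) ∂(Measure.pi fun _ : ι ↦ μ) := by
        simp_rw [ENNReal.ofReal_sum_of_nonneg fun _ _ ↦ hf0 _]
        exact lintegral_finsetSum _ fun i _ ↦ (hf.comp (measurable_pi_apply i)).ennreal_ofReal
    _ = ∑ _i : ι, ∫⁻ ω, ENNReal.ofReal (f ω) ∂μ := Finset.sum_congr rfl fun _ _ ↦
        (measurePreserving_eval (fun _ : ι ↦ μ) _).lintegral_comp hf.ennreal_ofReal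
    _ = _ := by rw [Finset.sum_const, Finset.card_univ, nsmul_eq_mul]

lemma measureReal_pi_le_sum_le (hf : Measurable f) (hf0 : ∀ ω, 0 ≤ f ω) {B : ℝ} (hB0 : 0 ≤ B)
    (hB : ∫⁻ ω, ENNReal.ofReal (f ω) ∂μ ≤ ENNReal.ofReal B) (ht : 0 < t) :
    (Measure.pi fun _ : ι ↦ μ).real {ω | t ≤ ∑ i, f (ω i)} ≤ Fintype.card ι * B / t := by
  have measurable : Measurable fun ω : ι → Ω ↦ ∑ i, f (ω i) :=
    Finset.measurable_sum _ fun i _ ↦ hf.comp (measurable_pi_apply i)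
  have set_eq : {ω : ι → Ω | ENNReal.ofReal t ≤ ENNReal.ofReal (∑ i, f (ω i))}
      = {ω | t ≤ ∑ i, f (ω i)} := by
    ext ω
    exact ENNReal.ofReal_le_ofReal_iff (Finset.sum_nonneg fun i _ ↦ hf0 _)
  have markov := (mul_meas_ge_le_lintegral (μ := Measure.pi fun _ : ι ↦ μ)
    measurable.ennreal_ofReal (ENNReal.ofReal t)).trans_eq (lintegral_pi_sum_eval hf hf0)
  rw [le_div_iff₀' ht, ← ENNReal.ofReal_le_ofReal_iff (by positivity), ENNReal.ofReal_mul ht.le,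
    ENNReal.ofReal_mul (by positivity), ENNReal.ofReal_natCast, ofReal_measureReal, ← set_eq]
  exact markov.trans (by gcongr)

lemma measureReal_pi_le_abs_sum_sub_le (hf : MemLp f 2 μ) (hfm : Measurable f) (ht : 0 < t) :
    (Measure.pi fun _ : ι ↦ μ).real
        {ω | t ≤ |∑ i, f (ω i) - Fintype.card ι * ∫ ω, f ω ∂μ|}
      ≤ Fintype.card ι * (∫ ω, f ω ^ 2 ∂μ) / t ^ 2 := by
  set S : (ι → Ω) → ℝ := ∑ i, fun ω ↦ f (ω i) with S_def
  have S_apply (ω : ι → Ω) : S ω = ∑ i, f (ω i) := Finset.sum_apply ..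
  have memLp_eval (i : ι) : MemLp (fun ω : ι → Ω ↦ f (ω i)) 2 (Measure.pi fun _ : ι ↦ μ) :=
    hf.comp_measurePreserving (measurePreserving_eval (fun _ : ι ↦ μ) i)
  have integral_S : ∫ ω, S ω ∂(Measure.pi fun _ : ι ↦ μ) = Fintype.card ι * ∫ ω, f ω ∂μ := by
    simp_rw [S_apply]
    rw [integral_finsetSum _ fun i _ ↦ (memLp_eval i).integrable (by norm_num)]
    simp_rw [integral_comp_eval (μ := fun _ : ι ↦ μ) hfm.aestronglyMeasurable]
    simp
  have variance_S : variance S (Measure.pi fun _ : ι ↦ μ)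
      ≤ Fintype.card ι * ∫ ω, f ω ^ 2 ∂μ := by
    rw [S_def, variance_sum_pi fun _ ↦ hf, Finset.sum_const, Finset.card_univ, nsmul_eq_mul]
    gcongr
    exact variance_le_expectation_sq hfm.aestronglyMeasurable
  have memLp_S : MemLp S 2 (Measure.pi fun _ : ι ↦ μ) := memLp_finsetSum' _ fun i _ ↦ memLp_eval i
  have chebyshev := meas_ge_le_variance_div_sq memLp_S ht
  rw [integral_S, ← ofReal_measureReal, ENNReal.ofReal_le_ofReal_iff
    (div_nonneg (variance_nonneg _ _) (by positivity))] at chebyshev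
  simp_rw [S_apply] at chebyshev
  exact chebyshev.trans (by gcongr)

end Independent

lemma IsStable.measureReal_deviation_le {p : ℝ} {ν : Measure ℝ} [IsProbabilityMeasure ν]
    (hν : IsStable p ν) (hp : 1 ≤ p) {m n k : ℕ} (hk : 0 < k) (y : Fin n → ℝ)
    {N : ℝ} (hN : (∑ j, |y j| ^ p) ^ (1 / 4 / p) = N) (hN0 : 0 < N) {η : ℝ} (hη : 0 < η) :
    (Measure.pi fun _ : Fin k ↦ Rooting.entryLaw m n ν).real
      {ω | k * (η * (quarterMoment ν * N)) ≤
        |∑ i, |∑ j, (ω i).1 j * y j| ^ (1 / 4 : ℝ) - k * (quarterMoment ν * N)|}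
      ≤ 80 / (k * η ^ 2) := by
  have hp0 : 0 < p := by linarith
  have moment_ge := hν.le_quarterMoment hp
  set g : (Fin n → ℝ) × (Fin m → ℝ) → ℝ := fun ω ↦ |∑ j, ω.1 j * y j| ^ (1 / 4 : ℝ)
  have measurable : Measurable g :=
    (measurable_abs_rpow (1 / 4)).comp ((measurable_sum_mul y).comp measurable_fst)
  have g_sq (ω : (Fin n → ℝ) × (Fin m → ℝ)) : g ω ^ 2 = |∑ j, ω.1 j * y j| ^ (1 / 2 : ℝ) := by
    rw [← Real.rpow_natCast, ← Real.rpow_mul (abs_nonneg _)]; norm_num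
  have memLp : MemLp g 2 (Rooting.entryLaw m n ν) := by
    rw [memLp_two_iff_integrable_sq measurable.aestronglyMeasurable]
    simp_rw [g_sq]
    exact (hν.integrable_pi_abs_rpow hp0 y
      (hν.integrable_abs_rpow hp (by norm_num) (by norm_num))).comp_fst _
  have mean : ∫ ω, g ω ∂(Rooting.entryLaw m n ν) = quarterMoment ν * N := by
    rw [integral_fun_fst (fun z : Fin n → ℝ ↦ |∑ j, z j * y j| ^ (1 / 4 : ℝ)),
      hν.integral_pi_abs_rpow hp0, hN, probReal_univ, one_smul, mul_comm, quarterMoment]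
  have second_moment : ∫ ω, g ω ^ 2 ∂(Rooting.entryLaw m n ν) ≤ 5 * N ^ 2 := by
    have norm_sq : (∑ j, |y j| ^ p) ^ (1 / 2 / p) = N ^ 2 := by
      rw [← hN, ← Real.rpow_mul_natCast (by positivity)]
      ring_nf
    have half_moment := hν.integral_abs_rpow_le hp (q := 1 / 2) (by norm_num) (by norm_num)
    simp_rw [g_sq]
    rw [integral_fun_fst (fun z : Fin n → ℝ ↦ |∑ j, z j * y j| ^ (1 / 2 : ℝ)),
      hν.integral_pi_abs_rpow hp0, norm_sq, probReal_univ, one_smul]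
    nlinarith [sq_nonneg N]
  have : (0 : ℝ) < k := by exact_mod_cast hk
  have deviation := measureReal_pi_le_abs_sum_sub_le (ι := Fin k) memLp measurable
    (t := k * (η * (quarterMoment ν * N))) (by positivity)
  rw [mean, Fintype.card_fin] at deviation
  calc _ ≤ _ := deviation
    _ ≤ k * (5 * N ^ 2) / (k * (η * (quarterMoment ν * N))) ^ 2 := by gcongr
    _ = 5 / (k * η ^ 2 * quarterMoment ν ^ 2) := by field_simp
    _ ≤ 5 / (k * η ^ 2 * (1 / 4) ^ 2) := by gcongr
    _ = _ := by field_simp; norm_num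

namespace Rooting

variable {m n : ℕ} (T : Rooting (Fin m)) (A A' b : ℕ)

/-- The event that all intermediate values of a sketch with `k` entries are in the range of the
floating point numbers and that the sketch determines `Fp` with relative error `O(η)`. -/
def goodEvent (ν : Measure ℝ) (p η : ℝ) (k : ℕ) (X : Fin m → Fin n → ℕ) :
    Set (Fin k → (Fin n → ℝ) × (Fin m → ℝ)) :=
  {ω | (∀ i v, |T.entry A b X (ω i) v| ≤ 2 ^ A') ∧
    |∑ i, |T.entry A b X (ω i) T.root| ^ (1 / 4 : ℝ)
      - k * (quarterMoment ν * Fp p X ^ (1 / 4 / p))|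
      ≤ k * (2 * η * (quarterMoment ν * Fp p X ^ (1 / 4 / p)))}

lemma measurableSet_goodEvent (ν : Measure ℝ) (p η : ℝ) (k : ℕ) (X : Fin m → Fin n → ℕ) :
    MeasurableSet (T.goodEvent A A' b ν p η k X) := by
  have measurable_entry (i : Fin k) (v : Fin m) :
      Measurable fun ω : Fin k → (Fin n → ℝ) × (Fin m → ℝ) ↦ T.entry A b X (ω i) v :=
    (T.measurable_entry A b X v).comp (measurable_pi_apply i)
  have measurable_sketch : Measurable fun ω : Fin k → (Fin n → ℝ) × (Fin m → ℝ) ↦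
      ∑ i, |T.entry A b X (ω i) T.root| ^ (1 / 4 : ℝ) :=
    Finset.measurable_sum _ fun i _ ↦ (measurable_abs_rpow (1 / 4)).comp (measurable_entry i T.root)
  simp only [goodEvent, Set.ofPred_and, Set.ofPred_forall]
  refine (MeasurableSet.iInter fun i ↦ MeasurableSet.iInter fun v ↦ ?_).inter ?_
  · exact measurableSet_le (measurable_entry i v).abs measurable_const
  · exact measurableSet_le (measurable_sketch.sub measurable_const).abs measurable_const

variable {A A' b} {p : ℝ} {ν : Measure ℝ} {η : ℝ} {k : ℕ}

lemma entry_eq_zero {X : Fin m → Fin n → ℕ} (hX : ∀ i j, X i j = 0)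
    (ω : (Fin n → ℝ) × (Fin m → ℝ)) (v : Fin m) : T.entry A b X ω v = 0 := by
  simp only [entry, hX, Nat.cast_zero, mul_zero, Finset.sum_const_zero]
  induction v using T.wellFounded_isChild.induction with
  | h v ih =>
    rw [noisy_eq, zero_add]
    refine Finset.sum_eq_zero fun w hw ↦ ?_
    rw [ih w (Finset.mem_filter.1 hw).2, fround_zero]

lemma goodEvent_eq_univ (hp : 0 < p) {X : Fin m → Fin n → ℕ} (hX : ∀ i j, X i j = 0) :
    T.goodEvent A A' b ν p η k X = Set.univ := by
  have Fp_eq_zero : Fp p X = 0 := by simp [Fp, hX, Real.zero_rpow hp.ne']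
  have norm_eq_zero : Fp p X ^ (1 / 4 / p) = 0 := by
    rw [Fp_eq_zero, Real.zero_rpow (by positivity)]
  refine Set.eq_univ_of_forall fun ω ↦ ⟨fun i v ↦ ?_, ?_⟩
  · rw [T.entry_eq_zero hX, abs_zero]
    positivity
  · rw [norm_eq_zero]
    simp [T.entry_eq_zero hX]

lemma mem_goodEvent {X : Fin m → Fin n → ℕ} {ω : Fin k → (Fin n → ℝ) × (Fin m → ℝ)}
    (form : |∑ i, |∑ j, (ω i).1 j * ∑ v, (X v j : ℝ)| ^ (1 / 4 : ℝ)
      - k * (quarterMoment ν * Fp p X ^ (1 / 4 / p))|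
      < k * (η * (quarterMoment ν * Fp p X ^ (1 / 4 / p))))
    (error : ∑ i, |T.entry A b X (ω i) T.root - ∑ j, (ω i).1 j * ∑ v, (X v j : ℝ)| ^ (1 / 4 : ℝ)
      < k * (η * (quarterMoment ν * Fp p X ^ (1 / 4 / p))))
    (range : ∀ v, ∑ i, |T.entry A b X (ω i) v| ^ (1 / 4 : ℝ) < ((2 : ℝ) ^ A') ^ (1 / 4 : ℝ)) :
    ω ∈ T.goodEvent A A' b ν p η k X := by
  refine ⟨fun i v ↦ ?_, ?_⟩
  · have single_le := Finset.single_le_sum (f := fun i ↦ |T.entry A b X (ω i) v| ^ (1 / 4 : ℝ))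
      (fun i _ ↦ Real.rpow_nonneg (abs_nonneg _) _) (Finset.mem_univ i)
    exact (Real.rpow_le_rpow_iff (abs_nonneg _) (by positivity) (by norm_num)).1
      (single_le.trans (range v).le)
  · have rounding : |∑ i, |T.entry A b X (ω i) T.root| ^ (1 / 4 : ℝ)
        - ∑ i, |∑ j, (ω i).1 j * ∑ v, (X v j : ℝ)| ^ (1 / 4 : ℝ)|
        ≤ ∑ i, |T.entry A b X (ω i) T.root - ∑ j, (ω i).1 j * ∑ v, (X v j : ℝ)|
          ^ (1 / 4 : ℝ) := by
      rw [← Finset.sum_sub_distrib]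
      exact (Finset.abs_sum_le_sum_abs _ _).trans
        (Finset.sum_le_sum fun i _ ↦ abs_abs_rpow_sub_le (by norm_num) (by norm_num) _ _)
    refine (abs_sub_le _ (∑ i, |∑ j, (ω i).1 j * ∑ v, (X v j : ℝ)| ^ (1 / 4 : ℝ)) _).trans ?_
    linarith

section Probability

variable [IsProbabilityMeasure ν] {D : ℕ} (hν : IsStable p ν) (hp : 1 ≤ p) (hp2 : p ≤ 2)
  (hD : ∀ v, T.depth v ≤ D) (hA : m * (1 / 4 : ℝ) ^ A ≤ 1)
  (hb : (1 / 4 : ℝ) ^ b * (D + 1) ≤ 1 / 2) (hk : 0 < k) {X : Fin m → Fin n → ℕ}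

include hν hp hp2 hD hA hb hk

lemma measureReal_rounding_error_le (hη : 0 < η) (hF : 1 ≤ Fp p X)
    (hbη : 384 * (D + 1) * ((1 / 4 : ℝ) ^ b) ^ (1 / 8 : ℝ) ≤ η) :
    (Measure.pi fun _ : Fin k ↦ entryLaw m n ν).real
      {ω | k * (η * (quarterMoment ν * Fp p X ^ (1 / 4 / p))) ≤ ∑ i,
        |T.entry A b X (ω i) T.root - ∑ j, (ω i).1 j * ∑ v, (X v j : ℝ)| ^ (1 / 4 : ℝ)}
      ≤ 1 / 24 := by
  have := hν.le_quarterMoment hp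
  have : (0 : ℝ) < k := by exact_mod_cast hk
  set N := Fp p X ^ (1 / 4 / p)
  have : 1 ≤ N := Real.one_le_rpow hF (by positivity)
  have measurable : Measurable fun ω : (Fin n → ℝ) × (Fin m → ℝ) ↦
      |T.entry A b X ω T.root - ∑ j, ω.1 j * ∑ v, (X v j : ℝ)| ^ (1 / 4 : ℝ) :=
    (measurable_abs_rpow (1 / 4)).comp ((T.measurable_entry A b X T.root).sub
      ((measurable_sum_mul fun j ↦ ∑ v, (X v j : ℝ)).comp measurable_fst))
  refine (measureReal_pi_le_sum_le measurable (fun ω ↦ Real.rpow_nonneg (abs_nonneg _) _)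
    (by positivity) (T.lintegral_entry_root_sub_le hν hp hp2 hD hA X hF hb)
    (by positivity)).trans ?_
  rw [Fintype.card_fin, div_le_div_iff₀ (by positivity) (by norm_num)]
  calc _ = (384 * (D + 1) * ((1 / 4 : ℝ) ^ b) ^ (1 / 8 : ℝ)) * (k * (quarterMoment ν * N)) := by
        ring
    _ ≤ η * (k * (quarterMoment ν * N)) := by gcongr
    _ = _ := by ring

lemma measureReal_overflow_le (hF : 1 ≤ Fp p X)
    (hA' : 1152 * (k * m * (D + 1)) * Fp p X ^ (1 / 4 / p) ≤ ((2 : ℝ) ^ A') ^ (1 / 4 : ℝ))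
    (v : Fin m) :
    (Measure.pi fun _ : Fin k ↦ entryLaw m n ν).real
      {ω | ((2 : ℝ) ^ A') ^ (1 / 4 : ℝ) ≤ ∑ i, |T.entry A b X (ω i) v| ^ (1 / 4 : ℝ)}
      ≤ 1 / (24 * m) := by
  have := hν.le_quarterMoment hp
  have : (0 : ℝ) < k := by exact_mod_cast hk
  have : (0 : ℝ) < m := by exact_mod_cast T.root.pos
  set N := Fp p X ^ (1 / 4 / p)
  have : 1 ≤ N := Real.one_le_rpow hF (by positivity)
  refine (measureReal_pi_le_sum_le ((measurable_abs_rpow (1 / 4)).comp (T.measurable_entry A b X v))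
    (fun ω ↦ Real.rpow_nonneg (abs_nonneg _) _) (by positivity)
    (T.lintegral_entry_le hν hp hp2 hD hA X hF hb v) (by positivity)).trans ?_
  rw [Fintype.card_fin, div_le_div_iff₀ (by positivity) (by positivity)]
  calc _ = (384 * quarterMoment ν) * ((k * m * (D + 1)) * N) := by ring
    _ ≤ (384 * 3) * ((k * m * (D + 1)) * N) := by gcongr; exact hν.quarterMoment_le hp
    _ = 1152 * (k * m * (D + 1)) * N := by ring
    _ ≤ _ := by rwa [one_mul]

theorem le_measureReal_goodEvent (hη : 0 < η)
    (hbη : 384 * (D + 1) * ((1 / 4 : ℝ) ^ b) ^ (1 / 8 : ℝ) ≤ η) (hkη : 1920 ≤ k * η ^ 2)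
    (hA' : 1152 * (k * m * (D + 1)) * Fp p X ^ (1 / 4 / p) ≤ ((2 : ℝ) ^ A') ^ (1 / 4 : ℝ)) :
    7 / 8 ≤ (Measure.pi fun _ : Fin k ↦ entryLaw m n ν).real (T.goodEvent A A' b ν p η k X) := by
  by_cases hX : ∀ i j, X i j = 0
  · rw [T.goodEvent_eq_univ (by linarith) hX, probReal_univ]
    norm_num
  push Not at hX
  obtain ⟨i, j, hij⟩ := hX
  have hF : 1 ≤ Fp p X := one_le_Fp (by linarith) hij
  have hm : (0 : ℝ) < m := by exact_mod_cast T.root.pos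
  have deviation := (hν.measureReal_deviation_le hp (m := m) hk (fun j ↦ ∑ v, (X v j : ℝ)) rfl
    (Real.rpow_pos_of_pos (zero_lt_one.trans_le hF) _) hη).trans
    (div_le_div_of_nonneg_left (by norm_num) (by norm_num) hkη)
  have rounding := T.measureReal_rounding_error_le hν hp hp2 hD hA hb hk hη hF hbη
  have overflow := T.measureReal_overflow_le hν hp hp2 hD hA hb hk hF hA'
  have compl_le : (Measure.pi fun _ : Fin k ↦ entryLaw m n ν).real
      (T.goodEvent A A' b ν p η k X)ᶜ ≤ 80 / 1920 + 1 / 24 + ∑ _v : Fin m, 1 / (24 * (m : ℝ)) := by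
    refine (measureReal_mono ?_).trans ((measureReal_union_le _ _).trans (add_le_add
      ((measureReal_union_le _ _).trans (add_le_add deviation rounding))
      ((measureReal_iUnion_fintype_le _).trans (Finset.sum_le_sum fun v _ ↦ overflow v))))
    intro ω hω
    by_contra not_bad
    simp only [Set.mem_union, Set.mem_iUnion, not_or, not_exists, Set.mem_ofPred_eq, not_le]
      at not_bad
    exact hω (T.mem_goodEvent not_bad.1.1 not_bad.1.2 not_bad.2)
  have sum_eq : ∑ _v : Fin m, 1 / (24 * (m : ℝ)) = 1 / 24 := by
    rw [Finset.sum_const, Finset.card_univ, Fintype.card_fin, nsmul_eq_mul]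
    field_simp
  rw [probReal_compl_eq_one_sub (T.measurableSet_goodEvent A A' b ν p η k X), sum_eq] at compl_le
  linarith

end Probability

end Rooting

/-! ### Simulating a probability space by coin tosses -/

lemma exists_sum_le_ncard_preimage {α β : Type*} [Fintype α] [Nonempty α] [Fintype β]
    {c : α → ℕ} (hc : ∑ a, c a ≤ Fintype.card β) :
    ∃ f : β → α, ∀ S : Finset α, ∑ a ∈ S, c a ≤ (f ⁻¹' S).ncard := by
  have card_le : Fintype.card (Σ a, Fin (c a)) ≤ Fintype.card β := by simpa using hc
  obtain ⟨emb⟩ := Function.Embedding.nonempty_of_card_le card_le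
  refine ⟨Function.extend emb Sigma.fst fun _ ↦ Classical.arbitrary α, fun S ↦ ?_⟩
  have subset : (((S.sigma fun a ↦ (Finset.univ : Finset (Fin (c a)))).map emb : Finset β) : Set β)
      ⊆ Function.extend emb Sigma.fst (fun _ ↦ Classical.arbitrary α) ⁻¹' S := by
    intro b hb
    obtain ⟨s, hs, rfl⟩ := Finset.mem_map.1 hb
    rw [Set.mem_preimage, emb.injective.extend_apply]
    exact (Finset.mem_sigma.1 hs).1
  have ncard_le := Set.ncard_le_ncard subset (Set.toFinite _)
  rw [Set.ncard_coe_finset, Finset.card_map, Finset.card_sigma] at ncard_le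
  simpa using ncard_le

lemma exists_coins_sub_le_coinProb_mem {α : Type*} [Finite α] [MeasurableSpace α]
    [MeasurableSingletonClass α] (ρ : Measure α) [IsProbabilityMeasure ρ] {δ : ℝ} (hδ : 0 < δ) :
    ∃ (R : ℕ) (f : (Fin R → Bool) → α),
      ∀ S : Finset α, ρ.real S - δ ≤ coinProb {ω | f ω ∈ S} := by
  have := Fintype.ofFinite α
  have : Nonempty α := nonempty_of_isProbabilityMeasure ρ
  obtain ⟨R, hR⟩ := pow_unbounded_of_one_lt (Fintype.card α / δ) one_lt_two
  have floor_le (a : α) : (⌊ρ.real {a} * 2 ^ R⌋₊ : ℝ) ≤ ρ.real {a} * 2 ^ R :=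
    Nat.floor_le (by positivity)
  have sum_floor_le : ∑ a, ⌊ρ.real {a} * 2 ^ R⌋₊ ≤ Fintype.card (Fin R → Bool) := by
    have : ((∑ a, ⌊ρ.real {a} * 2 ^ R⌋₊ : ℕ) : ℝ) ≤ 2 ^ R := by
      push_cast
      refine (Finset.sum_le_sum fun a _ ↦ floor_le a).trans_eq ?_
      rw [← Finset.sum_mul, sum_measureReal_singleton, Finset.coe_univ, probReal_univ, one_mul]
    simpa using (by exact_mod_cast this : ∑ a, ⌊ρ.real {a} * 2 ^ R⌋₊ ≤ 2 ^ R)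
  obtain ⟨f, hf⟩ := exists_sum_le_ncard_preimage sum_floor_le
  refine ⟨R, f, fun S ↦ ?_⟩
  rw [coinProb, le_div_iff₀ (by positivity)]
  calc _ = ρ.real S * 2 ^ R - δ * 2 ^ R := sub_mul ..
    _ ≤ ρ.real S * 2 ^ R - S.card := by
        gcongr
        have : (S.card : ℝ) ≤ Fintype.card α := by exact_mod_cast S.card_le_univ
        linarith [(div_lt_iff₀' hδ).1 hR]
    _ = ∑ a ∈ S, (ρ.real {a} * 2 ^ R - 1) := by
        rw [Finset.sum_sub_distrib, ← Finset.sum_mul, sum_measureReal_singleton]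
        simp
    _ ≤ ∑ a ∈ S, (⌊ρ.real {a} * 2 ^ R⌋₊ : ℝ) :=
        Finset.sum_le_sum fun a _ ↦ (Nat.sub_one_lt_floor _).le
    _ ≤ _ := by exact_mod_cast hf S

-- Finitely many events only see the pattern of which of them occur, a point of a finite space.
theorem exists_coins_simulation {Ω ι : Type*} [MeasurableSpace Ω] (μ : Measure Ω)
    [IsProbabilityMeasure μ] [Finite ι] {E : ι → Set Ω} (hE : ∀ i, MeasurableSet (E i)) {δ : ℝ}
    (hδ : 0 < δ) :
    ∃ (R : ℕ) (f : (Fin R → Bool) → Ω), ∀ i, μ.real (E i) - δ ≤ coinProb {ω | f ω ∈ E i} := by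
  classical
  have := Fintype.ofFinite ι
  let pattern : Ω → ι → Bool := fun ω i ↦ decide (ω ∈ E i)
  have measurable_pattern : Measurable pattern := measurable_pi_lambda _ fun i ↦
    measurable_to_bool (by simpa [pattern, Set.preimage] using hE i)
  have measurable_factor : Measurable (Set.rangeFactorization pattern) :=
    measurable_pattern.subtype_mk
  have := Measure.isProbabilityMeasure_map (μ := μ) measurable_factor.aemeasurable
  obtain ⟨R, f, hf⟩ :=
    exists_coins_sub_le_coinProb_mem (μ.map (Set.rangeFactorization pattern)) hδ
  let witness := Function.surjInv (Set.rangeFactorization_surjective (f := pattern))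
  refine ⟨R, witness ∘ f, fun i ↦ ?_⟩
  have pattern_witness (s : Set.range pattern) : witness s ∈ E i ↔ s.1 i = true := by
    have := congrArg Subtype.val (Function.surjInv_eq Set.rangeFactorization_surjective s)
    rw [← this]
    simp [pattern, witness, Set.rangeFactorization]
  have le_coinProb := hf (Finset.univ.filter fun s ↦ s.1 i = true)
  rw [map_measureReal_apply measurable_factor (Finset.measurableSet _)] at le_coinProb
  convert le_coinProb using 3
  · ext ω
    simp [pattern, Set.rangeFactorization]
  · simp [pattern_witness]

/-! ### Convergecast protocols -/

/-- A protocol along a rooted spanning tree of `G`: every vertex sends one message to its parent,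
computed from its input, the shared coins and the messages of its children, and the root turns what
it receives into the estimate. The messages received are given as a function of the sender, with
value `none` at the vertices that are not children. -/
structure Convergecast {m : ℕ} (G : SimpleGraph (Fin m)) (n : ℕ) where
  /-- the spanning tree -/
  tree : Rooting (Fin m)
  adj_parent : ∀ v, v ≠ tree.root → G.Adj v (tree.parent v)
  /-- a bound on the depth of the tree -/
  height : ℕ
  depth_le : ∀ v, tree.depth v ≤ height
  /-- the number of shared random bits -/
  coins : ℕ
  /-- the message of a vertex to its parent -/
  msg : Fin m → (Fin n → ℕ) → (Fin coins → Bool) → (Fin m → Option (List Bool)) → List Bool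
  /-- the estimate of the root -/
  out : (Fin n → ℕ) → (Fin coins → Bool) → (Fin m → Option (List Bool)) → ℝ

namespace Convergecast

variable {m n : ℕ} {G : SimpleGraph (Fin m)} (C : Convergecast G n)

/-- The convergecast as a protocol: the vertices of depth `s` send in round `height - s`, so that
all messages to a vertex arrive right before it sends. -/
def protocol : Protocol G n where
  coins := C.coins
  rounds := C.height
  target t i := if i ≠ C.tree.root ∧ t + C.tree.depth i = C.height then some (C.tree.parent i)
    else none
  target_adj t i j h := by
    split_ifs at h with sends
    obtain rfl := Option.some.inj h
    exact C.adj_parent i sends.1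
  message _ i x ω V := C.msg i x ω (V.getLast?.getD fun _ ↦ none)
  center := C.tree.root
  output x ω V := C.out x ω (V.getLast?.getD fun _ ↦ none)

lemma target_eq_some_iff {t : ℕ} {i j : Fin m} :
    C.protocol.target t i = some j ↔
      (i ≠ C.tree.root ∧ t + C.tree.depth i = C.height) ∧ C.tree.parent i = j := by
  simp only [protocol, Option.ite_none_right_eq_some, Option.some.injEq]

lemma target_eq_some_iff_isChild {t : ℕ} {i j : Fin m} :
    C.protocol.target t i = some j ↔ C.tree.IsChild i j ∧ t + C.tree.depth j + 1 = C.height := by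
  rw [target_eq_some_iff]
  constructor
  · rintro ⟨⟨ne_root, round⟩, rfl⟩
    have := C.tree.depth_parent i ne_root
    exact ⟨⟨by omega, rfl⟩, by omega⟩
  · rintro ⟨⟨depth_eq, parent_eq⟩, round⟩
    refine ⟨⟨fun h ↦ ?_, by omega⟩, parent_eq⟩
    have := (C.tree.depth_eq_zero i).2 h
    omega

lemma isOneShot_protocol : C.protocol.IsOneShot := by
  refine ⟨fun i hi ↦ ⟨C.height - C.tree.depth i, ?_, ?_, fun t _ ht ↦ ?_, fun s _ u hu ↦ ?_⟩,
    fun t _ ↦ ?_, C.height - 1, fun s _ u hu ↦ ?_⟩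
  · have := C.tree.depth_parent i hi
    have := C.depth_le i
    change _ < C.height
    omega
  · have := C.depth_le i
    exact Option.isSome_iff_exists.2 ⟨_, C.target_eq_some_iff.2 ⟨⟨hi, by omega⟩, rfl⟩⟩
  · refine Option.eq_none_iff_forall_ne_some.2 fun j hj ↦ ht ?_
    have := (C.target_eq_some_iff.1 hj).1.2
    omega
  · have := (C.target_eq_some_iff_isChild.1 hu).2
    omega
  · exact Option.eq_none_iff_forall_ne_some.2 fun j hj ↦ (C.target_eq_some_iff.1 hj).1.1 rfl
  · have := (C.target_eq_some_iff_isChild.1 hu).2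
    have : C.tree.depth C.protocol.center = 0 := (C.tree.depth_eq_zero _).2 rfl
    omega

section Execution

variable (X : Fin m → Fin n → ℕ) (ω : Fin C.coins → Bool) (S : Fin m → List Bool)

lemma getLast?_view_protocol (v : Fin m)
    (hS : ∀ w, C.tree.IsChild w v → C.protocol.message (C.height - C.tree.depth w) w (X w) ω
      (C.protocol.view X ω (C.height - C.tree.depth w) w) = S w) :
    ((C.protocol.view X ω (C.height - C.tree.depth v) v).getLast?.getD fun _ ↦ none)
      = fun w ↦ if C.tree.IsChild w v then some (S w) else none := by
  have := C.depth_le v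
  ext1 w
  rcases round : C.height - C.tree.depth v with _ | t
  · have not_child : ¬ C.tree.IsChild w v := fun child ↦ by
      have := C.depth_le w
      have := child.1
      omega
    rw [if_neg not_child]
    rfl
  simp only [Protocol.view, List.getLast?_append, List.getLast?_singleton, Option.some_or,
    Option.getD_some]
  have sends_iff : C.protocol.target t w = some v ↔ C.tree.IsChild w v := by
    rw [target_eq_some_iff_isChild]
    exact and_iff_left (by omega)
  rw [if_congr sends_iff rfl rfl]
  refine ite_congr rfl (fun child ↦ ?_) fun _ ↦ rfl
  have := child.1
  rw [← hS w child, show C.height - C.tree.depth w = t by omega]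

variable {S} (hS : ∀ v, S v = C.msg v (X v) ω fun w ↦
  if C.tree.IsChild w v then some (S w) else none)

include hS

lemma message_protocol (v : Fin m) :
    C.protocol.message (C.height - C.tree.depth v) v (X v) ω
      (C.protocol.view X ω (C.height - C.tree.depth v) v) = S v := by
  induction v using C.tree.wellFounded_isChild.induction with
  | h v ih =>
    rw [hS v, ← C.getLast?_view_protocol X ω S v ih]
    rfl

lemma result_protocol :
    C.protocol.result X ω = C.out (X C.tree.root) ω fun w ↦
      if C.tree.IsChild w C.tree.root then some (S w) else none := by
  rw [← C.getLast?_view_protocol X ω S C.tree.root fun w _ ↦ C.message_protocol X ω hS w,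
    (C.tree.depth_eq_zero _).2 rfl]
  rfl

end Execution

section Communication

variable {L : ℕ} (hL : ∀ v x ω F, (C.msg v x ω F).length ≤ L) (X : Fin m → Fin n → ℕ)
  (ω : Fin C.coins → Bool)

include hL

lemma bitsSent_protocol_le (i j : Fin m) :
    C.protocol.bitsSent X ω i j ≤ if C.tree.parent i = j then L else 0 := by
  have round_le (t : ℕ) : (if C.protocol.target t i = some j then
      (C.protocol.message t i (X i) ω (C.protocol.view X ω t i)).length else 0)
      ≤ if t = C.height - C.tree.depth i then (if C.tree.parent i = j then L else 0) else 0 := by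
    split_ifs with sends round parent_eq parent_eq
    · exact hL _ _ _ _
    · exact absurd (C.target_eq_some_iff.1 sends).2 parent_eq
    · have := (C.target_eq_some_iff.1 sends).1.2
      omega
    all_goals simp
  refine (Finset.sum_le_sum fun t _ ↦ round_le t).trans ?_
  rw [Finset.sum_ite_eq']
  split_ifs <;> simp

lemma maxComm_protocol_le : C.protocol.maxComm X ω ≤ 2 * L := by
  have bitsSent_le (i j : Fin m) : C.protocol.bitsSent X ω i j ≤ L :=
    (C.bitsSent_protocol_le hL X ω i j).trans (by split_ifs <;> simp)
  refine Finset.sup_le fun e _ ↦ (add_le_add (bitsSent_le _ _) (bitsSent_le _ _)).trans_eq ?_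
  ring

lemma totalComm_protocol_le : C.protocol.totalComm X ω ≤ m * L := by
  calc _ ≤ ∑ i, ∑ j, (if C.tree.parent i = j then L else 0) :=
        Finset.sum_le_sum fun i _ ↦ Finset.sum_le_sum fun j _ ↦ C.bitsSent_protocol_le hL X ω i j
    _ = _ := by simp

end Communication

end Convergecast

lemma exists_adj_dist_add_one_eq {V : Type*} {G : SimpleGraph V} (hG : G.Connected) {v r : V}
    (h : v ≠ r) : ∃ w, G.Adj v w ∧ G.dist w r + 1 = G.dist v r := by
  obtain ⟨walk, hwalk⟩ := hG.exists_walk_length_eq_dist v r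
  cases walk with
  | nil => exact absurd rfl h
  | @cons _ w _ adj walk =>
    refine ⟨w, adj, ?_⟩
    rw [SimpleGraph.Walk.length_cons] at hwalk
    have dist_le := SimpleGraph.dist_le walk
    have triangle := hG.dist_triangle (u := v) (v := w) (w := r)
    rw [SimpleGraph.dist_eq_one_iff_adj.2 adj] at triangle
    omega

lemma exists_rooting {V : Type*} [Finite V] {G : SimpleGraph V} (hG : G.Connected) :
    ∃ T : Rooting V, (∀ v, v ≠ T.root → G.Adj v (T.parent v)) ∧ ∀ v, T.depth v ≤ G.diam := by
  have := hG.nonempty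
  let r : V := Classical.arbitrary _
  have exists_parent (v : V) : ∃ w, v ≠ r → G.Adj v w ∧ G.dist w r + 1 = G.dist v r := by
    by_cases hv : v = r
    · exact ⟨v, fun h ↦ absurd hv h⟩
    · obtain ⟨w, hw⟩ := exists_adj_dist_add_one_eq hG hv
      exact ⟨w, fun _ ↦ hw⟩
  choose parent hparent using exists_parent
  exact ⟨⟨r, parent, fun v ↦ G.dist v r, fun v ↦ hG.dist_eq_zero_iff, fun v hv ↦ (hparent v hv).2⟩,
    fun v hv ↦ (hparent v hv).1,
    fun v ↦ SimpleGraph.dist_le_diam (SimpleGraph.connected_iff_ediam_ne_top.1 hG)⟩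

/-! ### The sketching protocol -/

lemma exists_code {α : Type*} [Finite α] [Nonempty α] {L : ℕ} (h : Nat.card α ≤ 2 ^ L) :
    ∃ (enc : α → List Bool) (dec : List Bool → α),
      Function.LeftInverse dec enc ∧ ∀ s, (enc s).length = L := by
  have := Fintype.ofFinite α
  have card_le : Fintype.card α ≤ Fintype.card (Fin L → Bool) := by
    simpa [Nat.card_eq_fintype_card] using h
  obtain ⟨e⟩ := Function.Embedding.nonempty_of_card_le card_le
  have injective : Function.Injective fun s ↦ List.ofFn (e s) :=
    List.ofFn_injective.comp e.injective
  exact ⟨fun s ↦ List.ofFn (e s), Function.invFun _, Function.leftInverse_invFun injective,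
    fun s ↦ List.length_ofFn⟩

lemma one_add_div_sixteen_rpow_le {ε q : ℝ} (hε : 0 ≤ ε) (hε1 : ε ≤ 1) (hq : q ≤ 8) :
    (1 + ε / 16) ^ q ≤ 1 + ε := by
  have exp_sub_one_le := Real.abs_exp_sub_one_le (x := ε / 2)
    (by rw [abs_of_nonneg (by linarith)]; linarith)
  rw [abs_of_nonneg (by linarith : 0 ≤ ε / 2)] at exp_sub_one_le
  calc (1 + ε / 16) ^ q ≤ (1 + ε / 16) ^ (8 : ℝ) :=
        Real.rpow_le_rpow_of_exponent_le (by linarith) hq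
    _ ≤ Real.exp (ε / 16) ^ (8 : ℝ) :=
        Real.rpow_le_rpow (by linarith) (by linarith [Real.add_one_le_exp (ε / 16)]) (by norm_num)
    _ = Real.exp (ε / 2) := by
        rw [← Real.exp_mul]
        ring_nf
    _ ≤ 1 + ε := by linarith [le_abs_self (Real.exp (ε / 2) - 1)]

lemma le_one_sub_div_sixteen_rpow {ε q : ℝ} (hε : 0 ≤ ε) (hε1 : ε ≤ 1) (hq : 1 ≤ q)
    (hq8 : q ≤ 8) : 1 - ε ≤ (1 - ε / 16) ^ q := by
  have bernoulli := one_add_mul_self_le_rpow_one_add (s := -(ε / 16)) (by linarith) hq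
  rw [← sub_eq_add_neg] at bernoulli
  nlinarith

lemma rpow_mem_Icc_of_abs_sub_le {F p ε s : ℝ} (hF : 0 ≤ F) (hp : 1 / 4 ≤ p) (hp2 : p ≤ 2)
    (hε : 0 ≤ ε) (hε1 : ε ≤ 1) (hs : |s - F ^ (1 / 4 / p)| ≤ ε / 16 * F ^ (1 / 4 / p)) :
    s ^ (4 * p) ∈ Set.Icc ((1 - ε) * F) ((1 + ε) * F) := by
  have root_nonneg : 0 ≤ F ^ (1 / 4 / p) := Real.rpow_nonneg hF _
  have root_rpow : (F ^ (1 / 4 / p)) ^ (4 * p) = F := by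
    rw [← Real.rpow_mul hF, show 1 / 4 / p * (4 * p) = 1 by field_simp, Real.rpow_one]
  obtain ⟨lower, upper⟩ := abs_le.1 hs
  have le_s : (1 - ε / 16) * F ^ (1 / 4 / p) ≤ s := by linarith
  have s_le : s ≤ (1 + ε / 16) * F ^ (1 / 4 / p) := by linarith
  have low_nonneg : 0 ≤ (1 - ε / 16) * F ^ (1 / 4 / p) := mul_nonneg (by linarith) root_nonneg
  constructor
  · calc (1 - ε) * F ≤ (1 - ε / 16) ^ (4 * p) * F := by
          gcongr
          exact le_one_sub_div_sixteen_rpow hε hε1 (by linarith) (by linarith)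
      _ = ((1 - ε / 16) * F ^ (1 / 4 / p)) ^ (4 * p) := by
          rw [Real.mul_rpow (by linarith) root_nonneg, root_rpow]
      _ ≤ s ^ (4 * p) := Real.rpow_le_rpow low_nonneg le_s (by linarith)
  · calc s ^ (4 * p) ≤ ((1 + ε / 16) * F ^ (1 / 4 / p)) ^ (4 * p) :=
          Real.rpow_le_rpow (low_nonneg.trans le_s) s_le (by linarith)
      _ = (1 + ε / 16) ^ (4 * p) * F := by
          rw [Real.mul_rpow (by linarith) root_nonneg, root_rpow]
      _ ≤ (1 + ε) * F := by
          gcongr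
          exact one_add_div_sixteen_rpow_le hε hε1 (by linarith)

/-- The estimate of `F_p` from the `k` entries of the sketch at the root: a normalized empirical
`1/4`-th moment, raised to the power that turns `F_p ^ (1 / (4 p))` into `F_p`. -/
noncomputable def estimate (ν : Measure ℝ) (p : ℝ) {k : ℕ} (y : Fin k → ℝ) : ℝ :=
  ((∑ i, |y i| ^ (1 / 4 : ℝ)) / (k * quarterMoment ν)) ^ (4 * p)

lemma Rooting.estimate_mem_Icc {m n k A A' b : ℕ} {T : Rooting (Fin m)} {ν : Measure ℝ} {p ε : ℝ}
    (hp : 1 / 4 ≤ p) (hp2 : p ≤ 2) (hε : 0 ≤ ε) (hε1 : ε ≤ 1) (hν : 0 < quarterMoment ν)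
    (hk : 0 < k) {X : Fin m → Fin n → ℕ} {ω : Fin k → (Fin n → ℝ) × (Fin m → ℝ)}
    (hω : ω ∈ T.goodEvent A A' b ν p (ε / 32) k X) :
    estimate ν p (fun i ↦ T.entry A b X (ω i) T.root)
      ∈ Set.Icc ((1 - ε) * Fp p X) ((1 + ε) * Fp p X) := by
  refine rpow_mem_Icc_of_abs_sub_le (Fp_nonneg p X) hp hp2 hε hε1 ?_
  have denominator_pos : 0 < k * quarterMoment ν := mul_pos (Nat.cast_pos.2 hk) hν
  rw [div_sub' denominator_pos.ne', abs_div, abs_of_pos denominator_pos,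
    div_le_iff₀ denominator_pos, mul_assoc (k : ℝ)]
  exact hω.2.trans_eq (by ring)

open Classical in
/-- The identity on the grid; numbers outside the grid, which a message cannot carry, become `0`. -/
noncomputable def toGrid (A A' b : ℕ) (y : ℝ) : grid A A' b :=
  if h : y ∈ grid A A' b then ⟨y, h⟩ else ⟨0, zero_mem_grid A A' b⟩

lemma coe_toGrid_of_mem {A A' b : ℕ} {y : ℝ} (h : y ∈ grid A A' b) :
    (toGrid A A' b y : ℝ) = y := by simp [toGrid, h]

section SketchConvergecast

variable (A A' b : ℕ) {k m n : ℕ} (T : Rooting (Fin m)) (ω : Fin k → (Fin n → ℝ) × (Fin m → ℝ))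
  (enc : (Fin k → grid A A' b) → List Bool) (dec : List Bool → Fin k → grid A A' b)

/-- The sketch of a vertex: its own contribution plus the sum of the sketches it received. -/
noncomputable def gather (x : Fin n → ℕ) (inbox : Fin m → Option (List Bool)) (i : Fin k) : ℝ :=
  ∑ j, (ω i).1 j * x j + ∑ w, (inbox w).elim 0 fun l ↦ (dec l i : ℝ)

/-- The message encoding a sketch `y` of the vertex `v`, rounded to the grid entry by entry. -/
noncomputable def encodeRounded (v : Fin m) (y : Fin k → ℝ) : List Bool :=
  enc fun i ↦ toGrid A A' b (fround A b (y i) ((ω i).2 v))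

/-- The sketches at the vertices when rounding is restricted to the grid. -/
noncomputable def gridEntry (X : Fin m → Fin n → ℕ) (v : Fin m) (i : Fin k) : ℝ :=
  T.agg (fun w y ↦ toGrid A A' b (fround A b y ((ω i).2 w))) (fun v ↦ ∑ j, (ω i).1 j * X v j) v

variable {A A' b enc dec}

lemma gather_eq_gridEntry (hdec : Function.LeftInverse dec enc) (X : Fin m → Fin n → ℕ)
    (v : Fin m) :
    gather A A' b ω dec (X v) (fun w ↦ if T.IsChild w v then
      some (encodeRounded A A' b ω enc w (gridEntry A A' b T ω X w)) else none)
      = gridEntry A A' b T ω X v := by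
  funext i
  rw [gather, gridEntry, T.agg_eq, Finset.sum_filter]
  congr 1
  refine Finset.sum_congr rfl fun w _ ↦ ?_
  split_ifs
  · rw [Option.elim_some, encodeRounded, hdec]
    rfl
  · rfl

lemma gridEntry_eq_entry (X : Fin m → Fin n → ℕ) (i : Fin k)
    (h : ∀ v, |T.entry A b X (ω i) v| ≤ 2 ^ A') (v : Fin m) :
    gridEntry A A' b T ω X v i = T.entry A b X (ω i) v :=
  T.agg_congr (fun v ↦ coe_toGrid_of_mem (fround_mem_grid (h v))) v

variable {G : SimpleGraph (Fin m)} {T} (hT : ∀ v, v ≠ T.root → G.Adj v (T.parent v)) {D : ℕ}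
  (hD : ∀ v, T.depth v ≤ D) {R : ℕ} (f : (Fin R → Bool) → Fin k → (Fin n → ℝ) × (Fin m → ℝ))
  (enc dec) (ν : Measure ℝ) (p : ℝ)

/-- The sketching protocol: the shared coins determine, through `f`, the coefficients of the sketch
and the random shifts of the rounding; every vertex sends its rounded sketch to its parent. -/
noncomputable def sketchConvergecast : Convergecast G n where
  tree := T
  adj_parent := hT
  height := D
  depth_le := hD
  coins := R
  msg v x ω inbox := encodeRounded A A' b (f ω) enc v (gather A A' b (f ω) dec x inbox)
  out x ω inbox := estimate ν p (gather A A' b (f ω) dec x inbox)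

variable {enc dec ν p}

lemma result_sketchConvergecast (hdec : Function.LeftInverse dec enc) (X : Fin m → Fin n → ℕ)
    (ω : Fin R → Bool) (h : ∀ i v, |T.entry A b X (f ω i) v| ≤ 2 ^ A') :
    (sketchConvergecast enc dec hT hD f ν p).protocol.result X ω
      = estimate ν p fun i ↦ T.entry A b X (f ω i) T.root := by
  have result_eq := (sketchConvergecast enc dec hT hD f ν p).result_protocol X ω
    (S := fun v ↦ encodeRounded A A' b (f ω) enc v (gridEntry A A' b T (f ω) X v))
    fun v ↦ congrArg _ (gather_eq_gridEntry T (f ω) hdec X v).symm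
  have gather_eq_entry : gather A A' b (f ω) dec (X T.root) (fun w ↦ if T.IsChild w T.root then
      some (encodeRounded A A' b (f ω) enc w (gridEntry A A' b T (f ω) X w)) else none)
      = fun i ↦ T.entry A b X (f ω i) T.root :=
    (gather_eq_gridEntry T (f ω) hdec X T.root).trans
      (funext fun i ↦ gridEntry_eq_entry T (f ω) X i (h i) T.root)
  exact result_eq.trans (congrArg (estimate ν p) gather_eq_entry)

end SketchConvergecast

lemma coinProb_mono {R : ℕ} {E F : Set (Fin R → Bool)} (h : E ⊆ F) : coinProb E ≤ coinProb F :=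
  div_le_div_of_nonneg_right (Nat.cast_le.2 (Set.ncard_le_ncard h (Set.toFinite _)))
    (by positivity)

lemma Convergecast.hasOneShotFpProtocol {m n M L : ℕ} {G : SimpleGraph (Fin m)}
    (C : Convergecast G n) (hL : ∀ v x ω F, (C.msg v x ω F).length ≤ L) {p ε B : ℝ}
    (hB : 2 * L ≤ B)
    (hC : ∀ X : Fin m → Fin n → ℕ, (∀ i j, X i j ≤ M) → 3 / 4 ≤ coinProb
      {ω | C.protocol.result X ω ∈ Set.Icc ((1 - ε) * Fp p X) ((1 + ε) * Fp p X)}) :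
    HasOneShotFpProtocol G n M p ε B := by
  refine ⟨C.protocol, C.isOneShot_protocol, fun X hX ↦ ⟨hC X hX, fun ω ↦ ⟨?_, ?_⟩⟩⟩
  · calc (C.protocol.maxComm X ω : ℝ) ≤ 2 * L := by exact_mod_cast C.maxComm_protocol_le hL X ω
      _ ≤ B := hB
  · calc (C.protocol.totalComm X ω : ℝ) ≤ m * L := by
          exact_mod_cast C.totalComm_protocol_le hL X ω
      _ ≤ m * B := by
          gcongr
          linarith [(Nat.cast_nonneg L : (0 : ℝ) ≤ L)]

theorem hasOneShotFpProtocol_of_parameters {m n M : ℕ} {G : SimpleGraph (Fin m)}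
    {T : Rooting (Fin m)} (hT : ∀ v, v ≠ T.root → G.Adj v (T.parent v)) {D : ℕ}
    (hD : ∀ v, T.depth v ≤ D) {p ε : ℝ} (hp : 1 ≤ p) (hp2 : p ≤ 2) (hε : 0 < ε) (hε1 : ε ≤ 1)
    {A A' b k L : ℕ} (hA : m * (1 / 4 : ℝ) ^ A ≤ 1) (hb : (1 / 4 : ℝ) ^ b * (D + 1) ≤ 1 / 2)
    (hbε : 384 * (D + 1) * ((1 / 4 : ℝ) ^ b) ^ (1 / 8 : ℝ) ≤ ε / 32)
    (hk : 0 < k) (hkε : 1920 ≤ k * (ε / 32) ^ 2)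
    (hA' : ∀ X : Fin m → Fin n → ℕ, (∀ i j, X i j ≤ M) →
      1152 * (k * m * (D + 1)) * Fp p X ^ (1 / 4 / p) ≤ ((2 : ℝ) ^ A') ^ (1 / 4 : ℝ))
    (hL : (grid A A' b).card ^ k ≤ 2 ^ L) {B : ℝ} (hB : 2 * L ≤ B) :
    HasOneShotFpProtocol G n M p ε B := by
  obtain ⟨ν, _, hν⟩ := exists_isStable (p := p) (by linarith) hp2
  have quarterMoment_pos : 0 < quarterMoment ν := by linarith [hν.le_quarterMoment hp]
  obtain ⟨R, f, hf⟩ := exists_coins_simulation (Measure.pi fun _ : Fin k ↦ Rooting.entryLaw m n ν)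
    (E := fun X : Fin m → Fin n → Fin (M + 1) ↦
      T.goodEvent A A' b ν p (ε / 32) k fun i j ↦ (X i j : ℕ))
    (fun X ↦ T.measurableSet_goodEvent A A' b ν p _ k _) (δ := 1 / 8) (by norm_num)
  have : Nonempty (Fin k → grid A A' b) := ⟨fun _ ↦ ⟨0, zero_mem_grid A A' b⟩⟩
  obtain ⟨enc, dec, hdec, length_enc⟩ := exists_code (α := Fin k → grid A A' b) (L := L) (by
    simpa using hL)
  refine (sketchConvergecast enc dec hT hD f ν p).hasOneShotFpProtocol
    (fun _ _ _ _ ↦ (length_enc _).le) hB fun X hX ↦ ?_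
  have correct (ω : Fin R → Bool) (hω : f ω ∈ T.goodEvent A A' b ν p (ε / 32) k X) :
      (sketchConvergecast enc dec hT hD f ν p).protocol.result X ω
        ∈ Set.Icc ((1 - ε) * Fp p X) ((1 + ε) * Fp p X) :=
    Set.mem_of_eq_of_mem (result_sketchConvergecast hT hD f hdec X ω hω.1)
      (Rooting.estimate_mem_Icc (by linarith) hp2 hε.le hε1 quarterMoment_pos hk hω)
  have good_le := T.le_measureReal_goodEvent hν hp hp2 hD hA hb hk (by positivity) hbε hkε
    (hA' X hX)
  have simulated := hf fun i j ↦ ⟨X i j, Nat.lt_succ_iff.2 (hX i j)⟩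
  calc 3 / 4 ≤ coinProb {ω | f ω ∈ T.goodEvent A A' b ν p (ε / 32) k X} := by linarith
    _ ≤ _ := coinProb_mono correct

lemma hasOneShotFpProtocol_of_forall_eq_zero {m n M : ℕ} {G : SimpleGraph (Fin m)}
    (hG : G.Connected) {p ε B : ℝ} (hp : p ≠ 0) (hB : 0 ≤ B)
    (h : ∀ X : Fin m → Fin n → ℕ, (∀ i j, X i j ≤ M) → ∀ i j, X i j = 0) :
    HasOneShotFpProtocol G n M p ε B := by
  obtain ⟨T, hT, hD⟩ := exists_rooting hG
  let silent : Convergecast G n := ⟨T, hT, G.diam, hD, 0, fun _ _ _ _ ↦ [], fun _ _ _ ↦ 0⟩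
  refine silent.hasOneShotFpProtocol (L := 0) (fun _ _ _ _ ↦ le_rfl) (by simpa using hB)
    fun X hX ↦ ?_
  have Fp_eq_zero : Fp p X = 0 := by simp [Fp, h X hX, Real.zero_rpow hp]
  have always_correct : {ω | silent.protocol.result X ω
      ∈ Set.Icc ((1 - ε) * Fp p X) ((1 + ε) * Fp p X)} = Set.univ := by
    refine Set.eq_univ_of_forall fun ω ↦ ?_
    rw [Set.mem_ofPred_eq, Fp_eq_zero, mul_zero, mul_zero]
    exact ⟨le_rfl, le_rfl⟩
  rw [always_correct, coinProb, Set.ncard_univ, Nat.card_eq_fintype_card, Fintype.card_pi_const,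
    Fintype.card_bool, Nat.cast_pow, Nat.cast_ofNat, div_self (by positivity)]
  norm_num

/-! ### Logarithmic bounds -/

/-- The number of bits needed to count up to `x`. -/
noncomputable def bitLength (x : ℝ) : ℕ := ⌈Real.logb 2 x⌉₊

lemma le_two_pow_bitLength {x : ℝ} (hx : 0 < x) : x ≤ 2 ^ bitLength x := by
  rw [← Real.rpow_natCast, ← Real.logb_le_iff_le_rpow one_lt_two hx]
  exact Nat.le_ceil _

lemma bitLength_le {x a : ℝ} (hx : 1 ≤ x) (hxa : Real.log x ≤ a) :
    (bitLength x : ℝ) ≤ 3 / 2 * a + 1 := by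
  have log_nonneg := Real.log_nonneg hx
  have logb_le : Real.logb 2 x ≤ 3 / 2 * Real.log x := by
    rw [Real.logb, div_le_iff₀ (Real.log_pos one_lt_two)]
    nlinarith [Real.log_two_gt_d9]
  linarith [Nat.ceil_lt_add_one (Real.logb_nonneg one_lt_two hx),
    show (bitLength x : ℝ) = ⌈Real.logb 2 x⌉₊ from rfl]

lemma log_le_of_le_two_pow {x : ℝ} (hx : 0 < x) {k : ℕ} (h : x ≤ 2 ^ k) :
    Real.log x ≤ k * (7 / 10) := by
  calc Real.log x ≤ Real.log (2 ^ k) := Real.log_le_log hx h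
    _ = k * Real.log 2 := Real.log_pow ..
    _ ≤ _ := by
        gcongr
        linarith [Real.log_two_lt_d9]

lemma log_one_add_le {x : ℝ} (hx : 0 ≤ x) : Real.log (1 + x) ≤ x := by
  linarith [Real.log_le_sub_one_of_pos (show 0 < 1 + x by linarith)]

lemma one_le_log_add_three {x : ℝ} (hx : 0 ≤ x) : 1 ≤ Real.log (x + 3) := by
  rw [Real.le_log_iff_exp_le (by linarith)]
  linarith [Real.exp_one_lt_d9]

lemma quarter_le_log_log {x : ℝ} (hx : 4 ≤ x) : 1 / 4 ≤ Real.log (Real.log x) := by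
  have log_four : Real.log 4 = 2 * Real.log 2 := by
    rw [show (4 : ℝ) = 2 ^ 2 by norm_num, Real.log_pow, Nat.cast_ofNat]
  have le_log : 4 / 3 ≤ Real.log x := by
    linarith [Real.log_le_log (by norm_num) hx, Real.log_two_gt_d9]
  calc (1 / 4 : ℝ) = 1 - (4 / 3)⁻¹ := by norm_num
    _ ≤ Real.log (4 / 3) := Real.one_sub_inv_le_log_of_pos (by norm_num)
    _ ≤ _ := Real.log_le_log (by norm_num) le_log

lemma log_natCast_add_one_le (D : ℕ) : Real.log (D + 1) ≤ Real.log D + 7 / 10 := by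
  rcases Nat.eq_zero_or_pos D with rfl | hD
  · norm_num
  have : (1 : ℝ) ≤ D := by exact_mod_cast hD
  calc Real.log (D + 1) ≤ Real.log (D * 2) := Real.log_le_log (by positivity) (by linarith)
    _ = Real.log D + Real.log 2 := Real.log_mul (by positivity) (by norm_num)
    _ ≤ _ := by linarith [Real.log_two_lt_d9]

lemma log_one_div_nonneg {ε : ℝ} (hε : 0 < ε) (hε1 : ε ≤ 1) : 0 ≤ Real.log (1 / ε) :=
  Real.log_nonneg ((one_le_div hε).2 hε1)

lemma log_log_le_of_le_pow {x y : ℝ} {J : ℕ} (hx : 1 < x) (hy : 4 ≤ y) (h : x ≤ y ^ J) :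
    Real.log (Real.log x) ≤ (1 + 4 * Real.log J) * Real.log (Real.log y) := by
  have J_ne_zero : J ≠ 0 := by
    rintro rfl
    rw [pow_zero] at h
    linarith
  have log_le : Real.log x ≤ J * Real.log y := by
    rw [← Real.log_pow]
    exact Real.log_le_log (by linarith) h
  calc Real.log (Real.log x) ≤ Real.log (J * Real.log y) :=
        Real.log_le_log (Real.log_pos hx) log_le
    _ = Real.log J + Real.log (Real.log y) :=
        Real.log_mul (by positivity) (Real.log_pos (by linarith)).ne'
    _ ≤ _ := by nlinarith [quarter_le_log_log hy, Real.log_natCast_nonneg J]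

/-! ### Choice of the parameters -/

lemma Fp_rpow_le {m n M : ℕ} {p : ℝ} (hp : 1 ≤ p) (hm : 0 < m) (hn : 0 < n) (hM : 0 < M)
    {X : Fin m → Fin n → ℕ} (hX : ∀ i j, X i j ≤ M) :
    Fp p X ^ (1 / 4 / p) ≤ m * n * M := by
  have : (1 : ℝ) ≤ n := by exact_mod_cast hn
  have one_le : (1 : ℝ) ≤ m * n * M := by exact_mod_cast Nat.mul_pos (Nat.mul_pos hm hn) hM
  have abs_sum_le (j : Fin n) : |∑ i, (X i j : ℝ)| ≤ m * M := by
    rw [abs_of_nonneg (Finset.sum_nonneg fun i _ ↦ Nat.cast_nonneg _)]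
    calc _ ≤ ∑ _i : Fin m, (M : ℝ) := Finset.sum_le_sum fun i _ ↦ by exact_mod_cast hX i j
      _ = _ := by simp
  have Fp_le : Fp p X ≤ (m * n * M) ^ p := by
    calc _ ≤ ∑ _j : Fin n, ((m : ℝ) * M) ^ p := Finset.sum_le_sum fun j _ ↦
          Real.rpow_le_rpow (abs_nonneg _) (abs_sum_le j) (by linarith)
      _ = n * (m * M : ℝ) ^ p := by simp
      _ ≤ (n : ℝ) ^ p * (m * M : ℝ) ^ p := by
          gcongr
          exact Real.self_le_rpow_of_one_le this hp
      _ = _ := by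
          rw [← Real.mul_rpow (by positivity) (by positivity)]
          ring_nf
  calc _ ≤ ((m * n * M : ℝ) ^ p) ^ (1 / 4 / p) :=
        Real.rpow_le_rpow (Fp_nonneg p X) Fp_le (by positivity)
    _ = (m * n * M : ℝ) ^ (1 / 4 : ℝ) := by
        rw [← Real.rpow_mul (by positivity), mul_div_cancel₀ _ (by positivity)]
    _ ≤ _ := Real.rpow_le_self_of_one_le one_le (by norm_num)

lemma one_div_four_pow_rpow (t : ℕ) : ((1 / 4 : ℝ) ^ (4 * t)) ^ (1 / 8 : ℝ) = (1 / 2) ^ t := by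
  rw [show (1 / 4 : ℝ) ^ (4 * t) = ((1 / 2) ^ t) ^ 8 by
    rw [show (1 / 4 : ℝ) = (1 / 2) ^ 2 by norm_num, ← pow_mul, ← pow_mul]
    ring_nf]
  simpa using Real.pow_rpow_inv_natCast (x := (1 / 2 : ℝ) ^ t) (by positivity)
    (n := 8) (by norm_num)

lemma two_pow_rpow (s : ℕ) : ((2 : ℝ) ^ (4 * s)) ^ (1 / 4 : ℝ) = 2 ^ s := by
  rw [mul_comm, pow_mul]
  simpa using Real.pow_rpow_inv_natCast (x := (2 : ℝ) ^ s) (by positivity) (n := 4) (by norm_num)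

-- The range `2 ^ A'` matters through its fourth root and the precision `4 ^ b` through its eighth
-- root, whence the choices `A' = 4 * s` and `b = 4 * t`.
lemma hasOneShotFpProtocol_of_bits {m n M : ℕ} {G : SimpleGraph (Fin m)} (hG : G.Connected)
    {p ε : ℝ} (hp : 1 ≤ p) (hp2 : p ≤ 2) (hε : 0 < ε) (hε1 : ε ≤ 1) (hn : 0 < n) (hM : 0 < M)
    {A s t k h : ℕ} (hA : (m : ℝ) ≤ 2 ^ A) (ht : 12288 * (G.diam + 1) / ε ≤ 2 ^ t)
    (hk : 1966080 / ε ^ 2 ≤ k) (hs : 1152 * (k * m * (G.diam + 1)) * (m * n * M) ≤ (2 : ℝ) ^ s)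
    (hh : (A + 4 * s + 1 : ℝ) ≤ 2 ^ h) {B : ℝ} (hB : 2 * (k * (h + (4 * t + 3))) ≤ B) :
    HasOneShotFpProtocol G n M p ε B := by
  obtain ⟨T, hT, hD⟩ := exists_rooting hG
  have k_pos : (0 : ℝ) < k := lt_of_lt_of_le (by positivity) hk
  have precision : (G.diam + 1 : ℝ) * (1 / 2) ^ t ≤ ε / 12288 := by
    rw [one_div_pow, mul_one_div, div_le_div_iff₀ (by positivity) (by norm_num)]
    linarith [(div_le_iff₀ hε).1 ht]
  refine hasOneShotFpProtocol_of_parameters hT hD hp hp2 hε hε1 (A := A) (A' := 4 * s)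
    (b := 4 * t) (L := k * (h + (4 * t + 3))) ?_ ?_ ?_ (Nat.cast_pos.1 k_pos) ?_
    (fun X hX ↦ ?_) ?_ (by exact_mod_cast hB)
  · calc (m : ℝ) * (1 / 4) ^ A ≤ 4 ^ A * (1 / 4) ^ A := by
          gcongr
          exact hA.trans (by gcongr; norm_num)
      _ = 1 := by rw [← mul_pow, mul_one_div_cancel (by norm_num), one_pow]
  · calc (1 / 4 : ℝ) ^ (4 * t) * (G.diam + 1) ≤ (1 / 2) ^ t * (G.diam + 1) := by
          gcongr
          exact (pow_le_pow_of_le_one (by norm_num) (by norm_num) (by omega)).trans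
            (pow_le_pow_left₀ (by norm_num) (by norm_num) t)
      _ ≤ 1 / 2 := by linarith
  · rw [one_div_four_pow_rpow]
    linarith
  · linarith [(div_le_iff₀ (by positivity)).1 hk]
  · rw [two_pow_rpow]
    refine le_trans ?_ hs
    gcongr
    exact Fp_rpow_le hp T.root.pos hn hM hX
  · rw [mul_comm k, pow_mul]
    gcongr
    refine (card_grid_le A (4 * s) (4 * t)).trans ?_
    rw [pow_add 2 h]
    gcongr
    exact_mod_cast hh

lemma log_div_eq_log_add {x ε : ℝ} (hx : 0 < x) (hε : 0 < ε) :
    Real.log (x / ε) = Real.log x + Real.log (1 / ε) := by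
  rw [div_eq_mul_one_div, Real.log_mul hx.ne' (by positivity)]

lemma mantissaBits_le {ε : ℝ} (hε : 0 < ε) (hε1 : ε ≤ 1) (D : ℕ) :
    (bitLength (12288 * (D + 1) / ε) : ℝ)
      ≤ 3 / 2 * (10 + Real.log (D + 1) + Real.log (1 / ε)) + 1 := by
  refine bitLength_le ?_ ?_
  · rw [one_le_div hε]
    linarith [(Nat.cast_nonneg D : (0 : ℝ) ≤ D)]
  · have log_le := log_le_of_le_two_pow (x := 12288) (by norm_num) (k := 14) (by norm_num)
    rw [log_div_eq_log_add (by positivity) hε, Real.log_mul (by norm_num) (by positivity)]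
    linarith

lemma rangeBits_le {k m D : ℕ} {E Q ℓ : ℝ} (hk : 0 < k) (hm : 0 < m) (hQ : 1 ≤ Q)
    (hkE : Real.log k ≤ 16 + 2 * E) (hmℓ : Real.log m ≤ ℓ) (hQℓ : Real.log Q ≤ ℓ) :
    (bitLength (1152 * (k * m * (D + 1)) * Q) : ℝ)
      ≤ 3 / 2 * (24 + 2 * E + 2 * ℓ + Real.log (D + 1)) + 1 := by
  refine bitLength_le ?_ ?_
  · have : (1 : ℝ) ≤ k * m * (D + 1) := by
      exact_mod_cast Nat.mul_pos (Nat.mul_pos hk hm) D.succ_pos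
    nlinarith
  · have log_le := log_le_of_le_two_pow (x := 1152) (by norm_num) (k := 11) (by norm_num)
    rw [Real.log_mul (by positivity) (by positivity), Real.log_mul (by norm_num) (by positivity),
      Real.log_mul (by positivity) (by positivity), Real.log_mul (by positivity) (by positivity)]
    linarith

lemma exponentBits_le {ℓ E d : ℝ} {A s : ℕ} (hℓ : 1 ≤ ℓ) (hE : 0 ≤ E) (hd : 0 ≤ d)
    (hA : A ≤ 3 / 2 * ℓ + 1) (hs : s ≤ 3 / 2 * (24 + 2 * E + 2 * ℓ + d) + 1) :
    (bitLength (A + 4 * s + 1) : ℝ) ≤ 3 / 2 * (6 + Real.log ℓ + E + d) + 1 := by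
  have product_le : (A + 4 * s + 1 : ℝ) ≤ 170 * ℓ * (1 + E) * (1 + d) := by
    have : 0 ≤ E * d := mul_nonneg hE hd
    have : 0 ≤ (ℓ - 1) * (E + d + E * d) := mul_nonneg (by linarith) (by linarith)
    linarith
  have log_le := log_le_of_le_two_pow (x := 170) (by norm_num) (k := 8) (by norm_num)
  refine bitLength_le (by linarith [(by positivity : (0 : ℝ) ≤ A + 4 * s)]) ?_
  calc Real.log (A + 4 * s + 1) ≤ Real.log (170 * ℓ * (1 + E) * (1 + d)) :=
        Real.log_le_log (by positivity) product_le
    _ = Real.log 170 + Real.log ℓ + Real.log (1 + E) + Real.log (1 + d) := by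
        rw [Real.log_mul (by positivity) (by positivity),
          Real.log_mul (by positivity) (by positivity), Real.log_mul (by norm_num) (by positivity)]
    _ ≤ _ := by linarith [log_one_add_le hE, log_one_add_le hd]

lemma sketchSize_le {ε : ℝ} (hε : 0 < ε) (hε1 : ε ≤ 1) :
    (⌈1966080 / ε ^ 2⌉₊ : ℝ) ≤ 3932160 / ε ^ 2 := by
  have : (1 : ℝ) ≤ 1966080 / ε ^ 2 := by
    rw [one_le_div (by positivity)]
    linarith [pow_le_one₀ (n := 2) hε.le hε1]
  calc _ ≤ 2 * (1966080 / ε ^ 2) := Nat.ceil_le_two_mul (by linarith)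
    _ = _ := by ring

lemma log_sketchSize_le {ε : ℝ} (hε : 0 < ε) (hε1 : ε ≤ 1) :
    Real.log ⌈1966080 / ε ^ 2⌉₊ ≤ 16 + 2 * Real.log (1 / ε) := by
  have log_le := log_le_of_le_two_pow (x := 3932160) (by norm_num) (k := 22) (by norm_num)
  calc _ ≤ Real.log (3932160 / ε ^ 2) :=
        Real.log_le_log (Nat.cast_pos.2 (Nat.ceil_pos.2 (by positivity))) (sketchSize_le hε hε1)
    _ = Real.log 3932160 + 2 * Real.log (1 / ε) := by
        rw [log_div_eq_log_add (by norm_num) (by positivity), ← one_div_pow, Real.log_pow,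
          Nat.cast_ofNat]
    _ ≤ _ := by linarith

lemma hasOneShotFpProtocol_of_pos {p ε : ℝ} (hp : 1 ≤ p) (hp2 : p ≤ 2) (hε : 0 < ε) (hε1 : ε ≤ 1)
    {n M m : ℕ} (hn : 0 < n) (hM : 0 < M) {G : SimpleGraph (Fin m)} (hG : G.Connected) :
    HasOneShotFpProtocol G n M p ε (10 ^ 10 / ε ^ 2 *
      (Real.log (Real.log (m * n * M + 3)) + Real.log G.diam + Real.log (1 / ε))) := by
  have hm : 0 < m := Fin.pos_iff_nonempty.2 hG.nonempty
  have m_le : (m : ℝ) ≤ m * n * M := by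
    exact_mod_cast (Nat.le_mul_of_pos_right m hn).trans (Nat.le_mul_of_pos_right _ hM)
  have m_ge : (1 : ℝ) ≤ m := by exact_mod_cast hm
  set Q : ℝ := m * n * M
  set ℓ := Real.log (Q + 3)
  set k := ⌈1966080 / ε ^ 2⌉₊
  have k_pos : 0 < k := Nat.ceil_pos.2 (by positivity)
  have hE := log_one_div_nonneg hε hε1
  have hd : 0 ≤ Real.log (G.diam + 1 : ℝ) := by exact_mod_cast Real.log_natCast_nonneg _
  have log_m_le : Real.log m ≤ ℓ := Real.log_le_log (by linarith) (by linarith)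
  have log_Q_le : Real.log Q ≤ ℓ := Real.log_le_log (by linarith) (by linarith)
  have mantissa_le := mantissaBits_le hε hε1 G.diam
  have range_le := rangeBits_le (D := G.diam) k_pos hm (m_ge.trans m_le)
    (log_sketchSize_le hε hε1) log_m_le log_Q_le
  have exponent_le := exponentBits_le (one_le_log_add_three (by linarith)) hE hd
    (bitLength_le m_ge log_m_le) range_le
  refine hasOneShotFpProtocol_of_bits hG hp hp2 hε hε1 hn hM (le_two_pow_bitLength (by linarith))
    (le_two_pow_bitLength (by positivity)) (Nat.le_ceil _) (le_two_pow_bitLength (by positivity))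
    (le_two_pow_bitLength (by positivity)) ?_
  set h := bitLength (bitLength m + 4 * bitLength (1152 * (k * m * (G.diam + 1)) * Q) + 1)
  set t := bitLength (12288 * (G.diam + 1) / ε)
  have entry_le : (h + (4 * t + 3) : ℝ)
      ≤ 400 * (Real.log ℓ + Real.log G.diam + Real.log (1 / ε)) := by
    linarith [quarter_le_log_log (show 4 ≤ Q + 3 by linarith), log_natCast_add_one_le G.diam,
      Real.log_natCast_nonneg G.diam]
  calc 2 * ((k : ℝ) * (h + (4 * t + 3)))
      ≤ 2 * (3932160 / ε ^ 2 * (400 * (Real.log ℓ + Real.log G.diam + Real.log (1 / ε)))) := by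
        gcongr
        exact sketchSize_le hε hε1
    _ = 3145728000 / ε ^ 2 * (Real.log ℓ + Real.log G.diam + Real.log (1 / ε)) := by ring
    _ ≤ _ := by
        gcongr
        · linarith [(by positivity : (0 : ℝ) ≤ h + (4 * t + 3))]
        · norm_num

theorem hasOneShotFpProtocol_log_log_mul {p ε : ℝ} (hp : 1 ≤ p) (hp2 : p ≤ 2) (hε : 0 < ε)
    (hε1 : ε ≤ 1) (n M : ℕ) {m : ℕ} {G : SimpleGraph (Fin m)} (hG : G.Connected) :
    HasOneShotFpProtocol G n M p ε (10 ^ 10 / ε ^ 2 *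
      (Real.log (Real.log (m * n * M + 3)) + Real.log G.diam + Real.log (1 / ε))) := by
  by_cases degenerate : n = 0 ∨ M = 0
  · have log_log_nonneg : 0 ≤ Real.log (Real.log (m * n * M + 3 : ℝ)) :=
      Real.log_nonneg (one_le_log_add_three (by positivity))
    refine hasOneShotFpProtocol_of_forall_eq_zero hG (by linarith) (mul_nonneg (by positivity)
      (add_nonneg (add_nonneg log_log_nonneg (Real.log_natCast_nonneg _))
        (log_one_div_nonneg hε hε1))) fun X hX i j ↦ ?_
    rcases degenerate with rfl | rfl
    · exact j.elim0
    · exact Nat.le_zero.1 (hX i j)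
  · push Not at degenerate
    exact hasOneShotFpProtocol_of_pos hp hp2 hε hε1 (Nat.pos_of_ne_zero degenerate.1)
      (Nat.pos_of_ne_zero degenerate.2) hG

lemma HasOneShotFpProtocol.mono {m n M : ℕ} {G : SimpleGraph (Fin m)} {p ε B B' : ℝ}
    (h : HasOneShotFpProtocol G n M p ε B) (hB : B ≤ B') : HasOneShotFpProtocol G n M p ε B' := by
  obtain ⟨P, oneShot, hP⟩ := h
  refine ⟨P, oneShot, fun X hX ↦ ⟨(hP X hX).1, fun ω ↦ ?_⟩⟩
  obtain ⟨maxComm_le, totalComm_le⟩ := (hP X hX).2 ω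
  exact ⟨maxComm_le.trans hB, totalComm_le.trans (by gcongr)⟩

lemma mul_mul_add_three_le_pow {c m n M : ℕ} (hn : 0 < n) (hm : m ≤ c * n ^ c)
    (hM : M ≤ c * n ^ c) : m * n * M + 3 ≤ (n + 3) ^ (c ^ 2 + 2 * c + 2) := by
  have product_le : m * n * M ≤ (n + 3) ^ (c ^ 2 + 2 * c + 1) := by
    calc m * n * M ≤ (c * n ^ c) * n * (c * n ^ c) := by gcongr
      _ = c ^ 2 * n ^ (2 * c + 1) := by ring
      _ ≤ (n + 3) ^ c ^ 2 * (n + 3) ^ (2 * c + 1) := Nat.mul_le_mul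
          (Nat.lt_two_pow_self.le.trans (Nat.pow_le_pow_left (by omega) _))
          (Nat.pow_le_pow_left (by omega) _)
      _ = _ := by ring
  have : 1 ≤ (n + 3) ^ (c ^ 2 + 2 * c + 1) := Nat.one_le_pow _ _ (by omega)
  rw [pow_succ]
  nlinarith

theorem hasOneShotFpProtocol_log_log {p ε : ℝ} (hp : 1 ≤ p) (hp2 : p ≤ 2) (hε : 0 < ε)
    (hε1 : ε ≤ 1) {c n M m : ℕ} {G : SimpleGraph (Fin m)} (hG : G.Connected) (hm : m ≤ c * n ^ c)
    (hM : M ≤ c * n ^ c) :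
    HasOneShotFpProtocol G n M p ε
      (10 ^ 10 * (1 + 4 * Real.log (c ^ 2 + 2 * c + 2 : ℕ)) / ε ^ 2 *
        (Real.log (Real.log (n + 3)) + Real.log G.diam + Real.log (1 / ε))) := by
  have m_pos : 0 < m := Fin.pos_iff_nonempty.2 hG.nonempty
  have n_pos : 0 < n := by
    by_contra! n_le
    obtain rfl := Nat.le_zero.1 n_le
    rcases eq_or_ne c 0 with rfl | hc
    · omega
    · rw [zero_pow hc] at hm
      omega
  have n_ge : (1 : ℝ) ≤ n := by exact_mod_cast n_pos
  have log_log_le := log_log_le_of_le_pow (x := m * n * M + 3) (y := n + 3)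
    (J := c ^ 2 + 2 * c + 2) (by linarith [(by positivity : (0 : ℝ) ≤ m * n * M)]) (by linarith)
    (by exact_mod_cast mul_mul_add_three_le_pow n_pos hm hM)
  have log_nonneg := Real.log_natCast_nonneg (c ^ 2 + 2 * c + 2)
  refine (hasOneShotFpProtocol_log_log_mul hp hp2 hε hε1 n M hG).mono ?_
  rw [mul_div_right_comm, mul_assoc _ (1 + _)]
  gcongr
  nlinarith [mul_nonneg log_nonneg (Real.log_natCast_nonneg G.diam),
    mul_nonneg log_nonneg (log_one_div_nonneg hε hε1)]

end MsgPassing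

theorem theorem3p4 :
    -- the bound in `log log n`, when `m` and `M` are polynomially bounded in `n`
    (∀ c : ℕ, ∃ K : ℝ, 0 < K ∧
      ∀ (p ε : ℝ), 1 < p → p ≤ 2 → 0 < ε → ε < 1 →
      ∀ (n M m : ℕ) (G : SimpleGraph (Fin m)), G.Connected →
      m ≤ c * n ^ c → M ≤ c * n ^ c →
      MsgPassing.HasOneShotFpProtocol G n M p ε
        (K / ε ^ 2 * (Real.log (Real.log (n + 3)) + Real.log G.diam + Real.log (1 / ε)))) ∧
    -- the bound for general `m, n, M`
    (∃ K : ℝ, 0 < K ∧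
      ∀ (p ε : ℝ), 1 < p → p ≤ 2 → 0 < ε → ε < 1 →
      ∀ (n M m : ℕ) (G : SimpleGraph (Fin m)), G.Connected →
      MsgPassing.HasOneShotFpProtocol G n M p ε
        (K / ε ^ 2 * (Real.log (Real.log (m * n * M + 3)) + Real.log G.diam
          + Real.log (1 / ε)))) := by
  refine ⟨fun c ↦ ⟨10 ^ 10 * (1 + 4 * Real.log (c ^ 2 + 2 * c + 2 : ℕ)), ?_, ?_⟩,
    10 ^ 10, by norm_num, ?_⟩
  · have := Real.log_natCast_nonneg (c ^ 2 + 2 * c + 2)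
    positivity
  · intro p ε hp hp2 hε hε1 n M m G hG hm hM
    exact MsgPassing.hasOneShotFpProtocol_log_log hp.le hp2 hε hε1.le hG hm hM
  · intro p ε hp hp2 hε hε1 n M m G hG
    exact MsgPassing.hasOneShotFpProtocol_log_log_mul hp.le hp2 hε hε1.le n M hG
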